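/- All Hilbert spaces are finite dimensional and nonzero, and $B(\mathcal H)$ denotes the operators on $\mathcal H$ with the operator norm. A channel from $\mathcal H_1$ to $\mathcal H_2$ (in the Heisenberg picture) is a completely positive unital linear map $T:B(\mathcal H_2)\to B(\mathcal H_1)$. For a linear map $T:B(\mathcal H_2)\to B(\mathcal H_1)$ let $$\|T\|_{cb}=\sup\{\|(T\otimes \mathrm{id}_n)(A)\| : n\in\mathbb N,\ A\in B(\mathcal H_2\otimes\mathbb C^n),\ \|A\|\le 1\}.$$ For a channel $T:B(\mathcal H_2)\to B(\mathcal H_1)$ and an integer $M\ge 1$ let $$\Delta(T,M)=\inf_{E,D}\|ETD-\mathrm{id}\|_{cb},$$ the infimum being over all channels $E:B(\mathcal H_1)\to B(\mathbb C^M)$ (encodings) and $D:B(\mathbb C^M)\to B(\mathcal H_2)$ (decodings). A real number $c\ge 0$ is an achievable rate for $T$ if $\lim_{n\to\infty}\Delta(T^{\otimes n},\lfloor 2^{cn}\rfloor)=0$, and the quantum capacity $Q(T)\in[0,\infty]$ is the supremum of all achievable rates. For $r\in[0,1]$ put $H_2(r)=-r\log_2 r-(1-r)\log_2(1-r)$,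 with $0\log_2 0=0$. Theorem. Let $T:B(\mathcal H_2)\to B(\mathcal H_1)$ be a channel, not necessarily between systems of the same dimension. (i) Let $k\ge 1$ be an integer, let $p$ be a prime, and suppose that there are channels $E:B(\mathcal H_1^{\otimes k})\to B(\mathbb C^p)$ and $D:B(\mathbb C^p)\to B(\mathcal H_2^{\otimes k})$ with $$\Delta:=\|ET^{\otimes k}D-\mathrm{id}_p\|_{cb}<\frac1{2e}.$$ Then $$Q(T)\ \ge\ \frac{\log_2 p}{k}\,(1-4e\Delta)-\frac1k\,H_2(2e\Delta).$$ (ii) Let $S(T)$ be the set of all numbers $\frac{\log_2 p}{k}(1-4e\Delta)-\frac1k H_2(2e\Delta)$ that arise from data $(k,p,E,D)$ as in (i). If $S(T)$ is nonempty, then $Q(T)$ is the least upper bound of $S(T)$; if $S(T)$ is empty, then $Q(T)=0$. -/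

import Mathlib

open scoped Matrix.Norms.L2Operator MatrixOrder ComplexOrder ENNReal

/-!
Finite-dimensional quantum channels in the Heisenberg picture.  The Hilbert space is `ℂ^ι` for a
finite index type `ι`, the observable algebra `B(ℂ^ι)` is `Matrix ι ι ℂ` with the operator norm,
`ℂ^ι ⊗ ℂ^k` is `ℂ^(ι × Fin k)`, and `(ℂ^ι)^{⊗ n}` is `ℂ^(Fin n → ι)`.
-/

namespace QuantumChannel

noncomputable section

/-- The ampliation `T ⊗ id_k : B(ℂ^κ ⊗ ℂ^k) → B(ℂ^ι ⊗ ℂ^k)` of a linear map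
`T : B(ℂ^κ) → B(ℂ^ι)`. -/
def ampliation {ι κ : Type*} (T : Matrix κ κ ℂ →ₗ[ℂ] Matrix ι ι ℂ) (k : ℕ) :
    Matrix (κ × Fin k) (κ × Fin k) ℂ →ₗ[ℂ] Matrix (ι × Fin k) (ι × Fin k) ℂ where
  toFun X := Matrix.of fun a b => T (Matrix.of fun x y => X (x, a.2) (y, b.2)) a.1 b.1
  map_add' X Y := by
    ext a b
    have h : (Matrix.of fun x y => (X + Y) (x, a.2) (y, b.2)) =
        (Matrix.of fun x y => X (x, a.2) (y, b.2)) + Matrix.of fun x y => Y (x, a.2) (y, b.2) := rfl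
    rw [Matrix.of_apply, h, map_add]
    rfl
  map_smul' c X := by
    ext a b
    have h : (Matrix.of fun x y => (c • X) (x, a.2) (y, b.2)) =
        c • (Matrix.of fun x y => X (x, a.2) (y, b.2)) := rfl
    rw [Matrix.of_apply, h, map_smul]
    rfl

/-- The norm of complete boundedness, the supremum over all `k` of the operator norms of
`T ⊗ id_k`, as an extended nonnegative real. -/
def cbNorm {ι κ : Type*} [Fintype ι] [DecidableEq ι] [Fintype κ] [DecidableEq κ]
    (T : Matrix κ κ ℂ →ₗ[ℂ] Matrix ι ι ℂ) : ℝ≥0∞ :=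
  ⨆ (k : ℕ) (A : Matrix (κ × Fin k) (κ × Fin k) ℂ) (_ : ‖A‖ ≤ 1), ‖ampliation T k A‖ₑ

/-- A quantum channel from the input system `ℂ^ι` to the output system `ℂ^κ`, in the Heisenberg
picture: a completely positive unital map `B(ℂ^κ) → B(ℂ^ι)`. -/
structure IsChannel {ι κ : Type*} [Fintype ι] [DecidableEq ι] [Fintype κ] [DecidableEq κ]
    (T : Matrix κ κ ℂ →ₗ[ℂ] Matrix ι ι ℂ) : Prop where
  unital : T 1 = 1
  completelyPositive :
    ∃ Φ : CompletelyPositiveMap (Matrix κ κ ℂ) (Matrix ι ι ℂ), Φ.toLinearMap = T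

/-- A block matrix over `Matrix κ κ ℂ` read as an operator on `ℂ^κ ⊗ ℂ^k`. -/
def flatten {κ : Type*} {k : ℕ} (M : CStarMatrix (Fin k) (Fin k) (Matrix κ κ ℂ)) :
    Matrix (κ × Fin k) (κ × Fin k) ℂ :=
  Matrix.of fun a b => M a.2 b.2 a.1 b.1

theorem flatten_star_mul_self {κ : Type*} [Fintype κ] [DecidableEq κ] {k : ℕ}
    (M : CStarMatrix (Fin k) (Fin k) (Matrix κ κ ℂ)) :
    flatten (star M * M) = (flatten M).conjTranspose * flatten M := by
  ext a b
  simp only [flatten, Matrix.of_apply, CStarMatrix.mul_apply, CStarMatrix.star_apply,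
    Matrix.mul_apply, Matrix.conjTranspose_apply, Fintype.sum_prod_type_right,
    Matrix.sum_apply, Matrix.star_apply]

theorem nonneg_iff_posSemidef_flatten {κ : Type*} [Fintype κ] [DecidableEq κ] {k : ℕ}
    (M : CStarMatrix (Fin k) (Fin k) (Matrix κ κ ℂ)) :
    0 ≤ M ↔ (flatten M).PosSemidef := by
  constructor
  · intro h
    rw [StarOrderedRing.nonneg_iff] at h
    induction h using AddSubmonoid.closure_induction with
    | mem x hx =>
      obtain ⟨B, rfl⟩ := hx
      change (flatten (star B * B)).PosSemidef
      rw [flatten_star_mul_self]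
      exact Matrix.posSemidef_conjTranspose_mul_self _
    | zero => exact Matrix.PosSemidef.zero
    | add x y _ _ hx hy => exact hx.add hy
  · intro h
    obtain ⟨C, hC⟩ := CStarAlgebra.nonneg_iff_eq_star_mul_self.mp h.nonneg
    let B : CStarMatrix (Fin k) (Fin k) (Matrix κ κ ℂ) :=
      CStarMatrix.ofMatrix (Matrix.of fun i j => Matrix.of fun x y => C (x, i) (y, j))
    have hB : flatten (star B * B) = flatten M := by
      rw [flatten_star_mul_self, hC]; rfl
    have hM : M = star B * B := by
      ext i j x y
      exact (congrFun (congrFun hB (x, i)) (y, j)).symm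
    rw [hM]
    exact star_mul_self_nonneg B

/-- Complete positivity in terms of ampliations: `T ⊗ id_k` maps positive semidefinite operators
to positive semidefinite operators, for every `k`. -/
theorem isChannel_iff {ι κ : Type*} [Fintype ι] [DecidableEq ι] [Fintype κ] [DecidableEq κ]
    (T : Matrix κ κ ℂ →ₗ[ℂ] Matrix ι ι ℂ) :
    IsChannel T ↔ T 1 = 1 ∧ ∀ (k : ℕ) (X : Matrix (κ × Fin k) (κ × Fin k) ℂ),
      X.PosSemidef → (ampliation T k X).PosSemidef := by
  constructor
  · rintro ⟨h1, Φ, rfl⟩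
    refine ⟨h1, fun k X hX => ?_⟩
    exact (nonneg_iff_posSemidef_flatten _).mp (Φ.map_cstarMatrix_nonneg' k
      (CStarMatrix.ofMatrix (Matrix.of fun i j => Matrix.of fun x y => X (x, i) (y, j)))
      ((nonneg_iff_posSemidef_flatten _).mpr hX))
  · rintro ⟨h1, h2⟩
    refine ⟨h1, ⟨T, fun k M hM => ?_⟩, rfl⟩
    exact (nonneg_iff_posSemidef_flatten _).mpr
      (h2 k _ ((nonneg_iff_posSemidef_flatten _).mp hM))

/-- The tensor power `T^{⊗ n}`, given by its values `⨂ᵢ T(E_{xᵢ yᵢ})` on the matrix units of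
`B((ℂ^κ)^{⊗ n})`. -/
def tensorPower {ι κ : Type*} [Fintype κ] [DecidableEq κ] (n : ℕ)
    (T : Matrix κ κ ℂ →ₗ[ℂ] Matrix ι ι ℂ) :
    Matrix (Fin n → κ) (Fin n → κ) ℂ →ₗ[ℂ] Matrix (Fin n → ι) (Fin n → ι) ℂ where
  toFun X := Matrix.of fun a b =>
    ∑ x, ∑ y, X x y * ∏ i, T (Matrix.single (x i) (y i) 1) (a i) (b i)
  map_add' X Y := by
    ext a b
    simp only [Matrix.of_apply, Matrix.add_apply, add_mul, Finset.sum_add_distrib]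
  map_smul' c X := by
    ext a b
    simp only [Matrix.of_apply, Matrix.smul_apply, smul_eq_mul, mul_assoc, Finset.mul_sum,
      RingHom.id_apply]

/-- `T^{⊗ n}(A₁ ⊗ ⋯ ⊗ Aₙ) = T(A₁) ⊗ ⋯ ⊗ T(Aₙ)`. -/
theorem tensorPower_apply_prod {ι κ : Type*} [Fintype κ] [DecidableEq κ] (n : ℕ)
    (T : Matrix κ κ ℂ →ₗ[ℂ] Matrix ι ι ℂ) (A : Fin n → Matrix κ κ ℂ) :
    tensorPower n T (Matrix.of fun x y => ∏ i, A i (x i) (y i)) =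
      Matrix.of fun a b => ∏ i, T (A i) (a i) (b i) := by
  have hT : ∀ (M : Matrix κ κ ℂ) (s t : ι),
      T M s t = ∑ x, ∑ y, M x y * T (Matrix.single x y 1) s t := by
    intro M s t
    have h : M = ∑ x, ∑ y, M x y • Matrix.single x y (1 : ℂ) := by
      refine (Matrix.matrix_eq_sum_single M).trans ?_
      simp only [Matrix.smul_single, smul_eq_mul, mul_one]
    have h' := congrArg T h
    simp only [map_sum, map_smul] at h'
    rw [h']
    simp only [Matrix.sum_apply, Matrix.smul_apply, smul_eq_mul]
  ext a b
  change ∑ x : Fin n → κ, ∑ y : Fin n → κ,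
    (∏ i, A i (x i) (y i)) * ∏ i, T (Matrix.single (x i) (y i) 1) (a i) (b i) =
      ∏ i, T (A i) (a i) (b i)
  have h1 : ∏ i, T (A i) (a i) (b i) =
      ∏ i, ∑ x, ∑ y, A i x y * T (Matrix.single x y 1) (a i) (b i) :=
    Finset.prod_congr rfl fun i _ => hT (A i) (a i) (b i)
  rw [h1, Fintype.prod_sum]
  refine Finset.sum_congr rfl fun x _ => ?_
  rw [Fintype.prod_sum]
  exact Finset.sum_congr rfl fun y _ => Finset.prod_mul_distrib.symm

/-- The cb-norm error of the encoding `E` and the decoding `D` of an `M`-level system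
through `T`. -/
def schemeError {ι κ : Type*} [Fintype ι] [DecidableEq ι] [Fintype κ] [DecidableEq κ] {M : ℕ}
    (T : Matrix κ κ ℂ →ₗ[ℂ] Matrix ι ι ℂ)
    (E : Matrix ι ι ℂ →ₗ[ℂ] Matrix (Fin M) (Fin M) ℂ)
    (D : Matrix (Fin M) (Fin M) ℂ →ₗ[ℂ] Matrix κ κ ℂ) : ℝ≥0∞ :=
  cbNorm (E ∘ₗ T ∘ₗ D - LinearMap.id)

/-- The best error level `Δ(T, M)` for coding an `M`-level system through `T`. -/
def codingError {ι κ : Type*} [Fintype ι] [DecidableEq ι] [Fintype κ] [DecidableEq κ]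
    (T : Matrix κ κ ℂ →ₗ[ℂ] Matrix ι ι ℂ) (M : ℕ) : ℝ≥0∞ :=
  ⨅ (E : Matrix ι ι ℂ →ₗ[ℂ] Matrix (Fin M) (Fin M) ℂ)
    (D : Matrix (Fin M) (Fin M) ℂ →ₗ[ℂ] Matrix κ κ ℂ)
    (_ : IsChannel E) (_ : IsChannel D), schemeError T E D

/-- `c ≥ 0` is an achievable rate if `Δ(T^{⊗ n}, ⌊2^{cn}⌋) → 0` as `n → ∞`. -/
def IsAchievableRate {ι κ : Type*} [Fintype ι] [DecidableEq ι] [Fintype κ] [DecidableEq κ]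
    (T : Matrix κ κ ℂ →ₗ[ℂ] Matrix ι ι ℂ) (c : ℝ) : Prop :=
  0 ≤ c ∧ Filter.Tendsto (fun n : ℕ => codingError (tensorPower n T) ⌊(2 : ℝ) ^ (c * n)⌋₊)
    Filter.atTop (nhds 0)

/-- The quantum capacity, the supremum of all achievable rates, as an extended real. -/
def capacity {ι κ : Type*} [Fintype ι] [DecidableEq ι] [Fintype κ] [DecidableEq κ]
    (T : Matrix κ κ ℂ →ₗ[ℂ] Matrix ι ι ℂ) : EReal :=
  sSup ((fun c : ℝ => (c : EReal)) '' {c | IsAchievableRate T c})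

/-- The Shannon entropy, in bits, of the probability distribution `(r, 1 - r)`. -/
def H₂ (r : ℝ) : ℝ :=
  -r * Real.logb 2 r - (1 - r) * Real.logb 2 (1 - r)

/-- The expression `(log₂ p / k) (1 - 4 e Δ) - (1 / k) H₂(2 e Δ)`. -/
def finiteCodingBound (k p : ℕ) (Δ : ℝ) : ℝ :=
  Real.logb 2 p / k * (1 - 4 * Real.exp 1 * Δ) - 1 / k * H₂ (2 * Real.exp 1 * Δ)

/-- A scheme coding a `p`-level system, `p` prime, through `k ≥ 1` parallel uses of `T`, with
cb-norm error less than `1 / (2e)`. -/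
structure IsFiniteScheme {ι κ : Type*} [Fintype ι] [DecidableEq ι] [Fintype κ] [DecidableEq κ]
    (T : Matrix κ κ ℂ →ₗ[ℂ] Matrix ι ι ℂ) (k p : ℕ)
    (E : Matrix (Fin k → ι) (Fin k → ι) ℂ →ₗ[ℂ] Matrix (Fin p) (Fin p) ℂ)
    (D : Matrix (Fin p) (Fin p) ℂ →ₗ[ℂ] Matrix (Fin k → κ) (Fin k → κ) ℂ) : Prop where
  one_le : 1 ≤ k
  prime : p.Prime
  encoding : IsChannel E
  decoding : IsChannel D
  error_lt : schemeError (tensorPower k T) E D < ENNReal.ofReal (1 / (2 * Real.exp 1))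

/-- All the values `(log₂ p / k) (1 - 4 e Δ) - (1 / k) H₂(2 e Δ)` for schemes as above. -/
def finiteCodingBounds {ι κ : Type*} [Fintype ι] [DecidableEq ι] [Fintype κ] [DecidableEq κ]
    (T : Matrix κ κ ℂ →ₗ[ℂ] Matrix ι ι ℂ) : Set EReal :=
  {b | ∃ (k p : ℕ) (E : Matrix (Fin k → ι) (Fin k → ι) ℂ →ₗ[ℂ] Matrix (Fin p) (Fin p) ℂ)
      (D : Matrix (Fin p) (Fin p) ℂ →ₗ[ℂ] Matrix (Fin k → κ) (Fin k → κ) ℂ),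
      IsFiniteScheme T k p E D ∧
      b = (finiteCodingBound k p (schemeError (tensorPower k T) E D).toReal : EReal)}

end

end QuantumChannel

namespace QuantumChannel

noncomputable section

open Matrix

/-! The lower bound comes from concatenating the given scheme with a random graph code. Let `S` be
the coded channel `E T^{⊗k} D` on a `p`-level system and write `S = id + R`, so that `R` has cb-norm
`Δ` and `R 1 = 0`. Expanding `S^{⊗n}` by multilinearity gives one term for each set `s` of sites,
with `R` on `s` and the identity elsewhere. A code correcting `f` errors turns every term with
`s.card ≤ f` into a multiple of the identity; since `R 1 = 0`, that multiple is zero unless `s` is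
empty, and the empty set contributes the identity itself. The error of the concatenated scheme is
therefore at most the sum of `Δ ^ s.card` over the sets with more than `f` elements
(`cbNorm_graphCode_le`). For `f ≈ θ n` a Chernoff estimate makes this sum decay exponentially as
soon as `θ > e Δ` (`sum_pow_card_le_exp`).

Graph codes over `ZMod p` reduce correction of `f` errors to a linear condition on matrices `U`,
`B`, tested on errors of weight at most `2 f`. A union bound over these errors and over the
differences `z` of logical labels shows that a good pair exists whenever the light errors are few
enough (`exists_detectsErrors`). Primality of `p` enters here: the counting divides by nonzero
elements of `ZMod p`. There are at most about `exp (n h(2θ)) p ^ (4θn)` light errors, `h` being the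
binary entropy in nats, which leaves any rate below `log p - 4θ log p - h(2θ)` nats per block;
letting `θ` decrease to `e Δ` gives the bound (`isAchievableRate_of_scheme`,
`finiteCodingBound_le_capacity`).

Conversely, an achievable rate `c > 0` provides, for large `N`, schemes of dimension `⌊2^{cN}⌋` with
small error. Bertrand's postulate gives a prime dimension at the cost of one bit, which is
negligible after division by `N`, as is the entropy term; so the bounds come arbitrarily close to
`c` or exceed it (`IsAchievableRate.le_of_mem_upperBounds`). The rate `c = 0` is separate: the
bounds might all be negative, were it not that spreading one scheme over more uses of `T` brings its
bound to zero (`nonneg_of_mem_upperBounds`). -/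

/-- The star homomorphism of matrix algebras given by relabelling the indices. -/
def reindexHom {ι κ : Type*} [Fintype ι] [DecidableEq ι] [Fintype κ] [DecidableEq κ] (e : κ ≃ ι) :
    Matrix κ κ ℂ →⋆ₐ[ℂ] Matrix ι ι ℂ :=
  { (reindexAlgEquiv ℂ ℂ e).toAlgHom with
    map_star' := fun X => by ext a b; simp [star_apply] }

@[simp]
theorem reindexHom_apply {ι κ : Type*} [Fintype ι] [DecidableEq ι] [Fintype κ] [DecidableEq κ]
    (e : κ ≃ ι) (X : Matrix κ κ ℂ) (a b : ι) :
    reindexHom e X a b = X (e.symm a) (e.symm b) := rfl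

theorem reindexHom_symm_reindexHom {ι κ : Type*} [Fintype ι] [DecidableEq ι] [Fintype κ]
    [DecidableEq κ] (e : κ ≃ ι) (X : Matrix κ κ ℂ) :
    reindexHom e.symm (reindexHom e X) = X := by
  ext a b; simp

theorem norm_reindexHom {ι κ : Type*} [Fintype ι] [DecidableEq ι] [Fintype κ] [DecidableEq κ]
    (e : κ ≃ ι) (X : Matrix κ κ ℂ) : ‖reindexHom e X‖ = ‖X‖ := by
  refine le_antisymm (NonUnitalStarAlgHom.norm_apply_le _ _) ?_
  conv_lhs => rw [← reindexHom_symm_reindexHom e X]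
  exact NonUnitalStarAlgHom.norm_apply_le _ _

/-- The embedding `X ↦ X ⊗ 1` of `B(ℂ^κ)` into `B(ℂ^κ ⊗ ℂ^r)`. -/
def tensorOne {κ : Type*} [Fintype κ] [DecidableEq κ] (r : Type*) [Fintype r] [DecidableEq r] :
    Matrix κ κ ℂ →⋆ₐ[ℂ] Matrix (κ × r) (κ × r) ℂ where
  toFun X := blockDiagonal fun _ => X
  map_one' := blockDiagonal_one
  map_mul' X Y := blockDiagonal_mul _ _
  map_zero' := blockDiagonal_zero
  map_add' X Y := blockDiagonal_add _ _
  commutes' c := by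
    simp only [Algebra.algebraMap_eq_smul_one]
    refine (blockDiagonal_smul c (fun _ => (1 : Matrix κ κ ℂ))).trans ?_
    exact congrArg _ blockDiagonal_one
  map_star' X := (blockDiagonal_conjTranspose _).symm

theorem tensorOne_apply {κ r : Type*} [Fintype κ] [DecidableEq κ] [Fintype r] [DecidableEq r]
    (X : Matrix κ κ ℂ) : tensorOne r X = blockDiagonal fun _ => X := rfl

/-! ### Kraus maps and their ampliations. -/

/-- The linear map `X ↦ A X B`. -/
def sandwich {ι κ : Type*} [Fintype κ] (A : Matrix ι κ ℂ) (B : Matrix κ ι ℂ) :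
    Matrix κ κ ℂ →ₗ[ℂ] Matrix ι ι ℂ where
  toFun X := A * X * B
  map_add' X Y := by rw [Matrix.mul_add, Matrix.add_mul]
  map_smul' c X := by rw [Matrix.mul_smul, Matrix.smul_mul, RingHom.id_apply]

@[simp]
theorem sandwich_apply {ι κ : Type*} [Fintype κ] (A : Matrix ι κ ℂ) (B : Matrix κ ι ℂ)
    (X : Matrix κ κ ℂ) : sandwich A B X = A * X * B := rfl

/-- The completely positive map with Kraus operators `K j`. -/
def krausMap {ι κ r : Type*} [Fintype κ] [Fintype r] (K : r → Matrix κ ι ℂ) :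
    Matrix κ κ ℂ →ₗ[ℂ] Matrix ι ι ℂ :=
  ∑ j, sandwich (K j)ᴴ (K j)

theorem krausMap_apply {ι κ r : Type*} [Fintype κ] [Fintype r] (K : r → Matrix κ ι ℂ)
    (X : Matrix κ κ ℂ) : krausMap K X = ∑ j, (K j)ᴴ * X * K j := by
  simp [krausMap, LinearMap.sum_apply]

/-- The ampliation `T ⊗ id` with an arbitrary index type. -/
def amp {ι κ : Type*} (m : Type*) (T : Matrix κ κ ℂ →ₗ[ℂ] Matrix ι ι ℂ) :
    Matrix (κ × m) (κ × m) ℂ →ₗ[ℂ] Matrix (ι × m) (ι × m) ℂ where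
  toFun X := of fun a b => T (of fun x y => X (x, a.2) (y, b.2)) a.1 b.1
  map_add' X Y := by
    ext a b
    exact congrFun (congrFun (map_add T (of fun x y => X (x, a.2) (y, b.2))
      (of fun x y => Y (x, a.2) (y, b.2))) a.1) b.1
  map_smul' c X := by
    ext a b
    exact congrFun (congrFun (map_smul T c (of fun x y => X (x, a.2) (y, b.2))) a.1) b.1

theorem amp_fin {ι κ : Type*} (k : ℕ) (T : Matrix κ κ ℂ →ₗ[ℂ] Matrix ι ι ℂ) :
    amp (Fin k) T = ampliation T k := rfl

theorem amp_comp {ι κ μ : Type*} (m : Type*) (S : Matrix κ κ ℂ →ₗ[ℂ] Matrix ι ι ℂ)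
    (T : Matrix μ μ ℂ →ₗ[ℂ] Matrix κ κ ℂ) : amp m (S ∘ₗ T) = amp m S ∘ₗ amp m T := rfl

theorem amp_add {ι κ : Type*} (m : Type*) (S T : Matrix κ κ ℂ →ₗ[ℂ] Matrix ι ι ℂ) :
    amp m (S + T) = amp m S + amp m T := rfl

theorem amp_sandwich {ι κ : Type*} [Fintype κ] (m : Type*) [Fintype m] [DecidableEq m]
    (A : Matrix ι κ ℂ) (B : Matrix κ ι ℂ) :
    amp m (sandwich A B) =
      sandwich (blockDiagonal fun _ : m => A) (blockDiagonal fun _ : m => B) := by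
  refine LinearMap.ext fun X => ?_
  ext ⟨a, i⟩ ⟨b, j⟩
  simp [amp, Matrix.mul_apply, blockDiagonal_apply, Fintype.sum_prod_type]

theorem amp_krausMap {ι κ r : Type*} [Fintype κ] [Fintype r] (m : Type*) [Fintype m]
    [DecidableEq m] (K : r → Matrix κ ι ℂ) :
    amp m (krausMap K) = krausMap fun j => blockDiagonal fun _ : m => K j := by
  have h : amp m (krausMap K) = ∑ j, amp m (sandwich (K j)ᴴ (K j)) := by
    refine LinearMap.ext fun X => ?_
    ext a b
    simp [amp, krausMap, LinearMap.sum_apply, Matrix.sum_apply]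
  rw [h, krausMap]
  refine Finset.sum_congr rfl fun j _ => ?_
  rw [amp_sandwich, blockDiagonal_conjTranspose]

/-! ### Channels and the norm of complete boundedness. -/

section

variable {ι κ μ : Type*} [Fintype ι] [DecidableEq ι] [Fintype κ] [DecidableEq κ]
  [Fintype μ] [DecidableEq μ]

omit [DecidableEq ι] [DecidableEq κ] in
theorem posSemidef_krausMap {r : Type*} [Fintype r] (K : r → Matrix κ ι ℂ) {X : Matrix κ κ ℂ}
    (hX : X.PosSemidef) : (krausMap K X).PosSemidef := by
  rw [krausMap_apply]
  exact posSemidef_sum _ fun j _ => hX.conjTranspose_mul_mul_same (K j)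

theorem isChannel_krausMap {r : Type*} [Fintype r] {K : r → Matrix κ ι ℂ}
    (hK : krausMap K 1 = 1) : IsChannel (krausMap K) := by
  refine (isChannel_iff _).mpr ⟨hK, fun k X hX => ?_⟩
  rw [← amp_fin, amp_krausMap]
  exact posSemidef_krausMap _ hX

/-- Choi's theorem: every channel has a Kraus representation. -/
theorem IsChannel.exists_krausMap {T : Matrix κ κ ℂ →ₗ[ℂ] Matrix ι ι ℂ} (hT : IsChannel T) :
    ∃ K : ι × Fin (Fintype.card κ) → Matrix κ ι ℂ, T = krausMap K := by
  obtain ⟨-, h⟩ := (isChannel_iff T).mp hT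
  let e := Fintype.equivFin κ
  -- The unnormalised maximally entangled vector, as a row. The blocks of `vᴴ * v` are the matrix
  -- units, so its image under the ampliation is the Choi matrix; the rows of a square root `C` of
  -- that matrix are the Kraus operators.
  let v : Matrix (Fin 1) (κ × Fin (Fintype.card κ)) ℂ := of fun _ a => if e a.1 = a.2 then 1 else 0
  obtain ⟨C, hC⟩ := CStarAlgebra.nonneg_iff_eq_star_mul_self.mp
    (h _ _ (posSemidef_conjTranspose_mul_self v)).nonneg
  have hT' : ∀ x y a b, T (single x y 1) a b = ∑ j, star (C j (a, e x)) * C j (b, e y) := by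
    intro x y a b
    have h1 := congrFun (congrFun hC (a, e x)) (b, e y)
    rw [mul_apply] at h1
    simp only [star_apply] at h1
    rw [← h1]
    simp only [ampliation, LinearMap.coe_mk, AddHom.coe_mk, of_apply]
    have h2 : single x y (1 : ℂ) = of fun x' y' => (vᴴ * v) (x', e x) (y', e y) := by
      ext x' y'
      simp only [v, mul_apply, single_apply, ite_and, conjTranspose_apply, of_apply,
        Finset.univ_unique, Finset.sum_singleton, e.apply_eq_iff_eq, eq_comm]
      split_ifs <;> simp
    rw [h2]
  refine ⟨fun j => of fun y b => C j (b, e y), ext_linearMap _ ?_⟩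
  intro x y
  refine LinearMap.ext_ring ?_
  ext a b
  simp only [LinearMap.comp_apply, singleLinearMap_apply]
  rw [hT', krausMap_apply, Matrix.sum_apply]
  refine Finset.sum_congr rfl fun j _ => ?_
  simp [mul_apply, single_apply, ite_and, ite_mul]

theorem isChannel_starAlgHom (π : Matrix κ κ ℂ →⋆ₐ[ℂ] Matrix ι ι ℂ) :
    IsChannel π.toAlgHom.toLinearMap :=
  ⟨map_one π, CompletelyPositiveMapClass.toCompletelyPositiveLinearMap π, rfl⟩

theorem isChannel_id : IsChannel (LinearMap.id : Matrix κ κ ℂ →ₗ[ℂ] Matrix κ κ ℂ) :=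
  isChannel_starAlgHom (StarAlgHom.id ℂ _)

theorem IsChannel.comp {S : Matrix κ κ ℂ →ₗ[ℂ] Matrix ι ι ℂ} {T : Matrix μ μ ℂ →ₗ[ℂ] Matrix κ κ ℂ}
    (hS : IsChannel S) (hT : IsChannel T) : IsChannel (S ∘ₗ T) := by
  rw [isChannel_iff] at *
  refine ⟨by rw [LinearMap.comp_apply, hT.1, hS.1], fun k X hX => ?_⟩
  exact hS.2 k _ (hT.2 k X hX)

theorem isChannel_sandwich {V : Matrix κ ι ℂ} (hV : Vᴴ * V = 1) : IsChannel (sandwich Vᴴ V) := by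
  have h : sandwich Vᴴ V = krausMap fun _ : Unit => V := by simp [krausMap]
  rw [h]
  exact isChannel_krausMap (by simp [krausMap, hV])

/-- For an isometry `W` the decoding `X ↦ W X Wᴴ + X₀₀ (1 - W Wᴴ)`. -/
def isometryDecoder (W : Matrix κ ι ℂ) (i : ι) : Matrix ι ι ℂ →ₗ[ℂ] Matrix κ κ ℂ :=
  sandwich W Wᴴ + (LinearMap.toSpanSingleton ℂ _ (1 - W * Wᴴ)) ∘ₗ entryLinearMap ℂ ℂ i i

omit [DecidableEq ι] [Fintype κ] in
theorem isometryDecoder_apply (W : Matrix κ ι ℂ) (i : ι) (X : Matrix ι ι ℂ) :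
    isometryDecoder W i X = W * X * Wᴴ + X i i • (1 - W * Wᴴ) := rfl

/-- With `Q = 1 - W Wᴴ` a projection, `X i i • Q = X i i • (Q Qᴴ)` is the sum of Kraus terms whose
operators send the conjugated columns of `Q` to the row `i`. This term restores unitality off the
range of `W`. -/
theorem isChannel_isometryDecoder {W : Matrix κ ι ℂ} (hW : Wᴴ * W = 1) (i : ι) :
    IsChannel (isometryDecoder W i) := by
  have hQ : (1 - W * Wᴴ) * (1 - W * Wᴴ)ᴴ = 1 - W * Wᴴ := by
    have : W * Wᴴ * (W * Wᴴ) = W * Wᴴ := by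
      rw [Matrix.mul_assoc, ← Matrix.mul_assoc Wᴴ, hW, Matrix.one_mul]
    simp [Matrix.mul_sub, Matrix.sub_mul, this]
  have h : isometryDecoder W i = krausMap (Option.elim · Wᴴ
      fun k : κ => of fun x y =>
        if x = i then star ((1 - W * Wᴴ : Matrix κ κ ℂ) y k) else 0) := by
    refine LinearMap.ext fun X => ?_
    rw [krausMap_apply, Fintype.sum_option, isometryDecoder_apply]
    simp only [Option.elim, conjTranspose_conjTranspose]
    congr 1
    conv_lhs => rw [← hQ]
    ext a b
    simp only [Matrix.sum_apply, mul_apply, Matrix.smul_apply, conjTranspose_apply, of_apply,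
      smul_eq_mul, Finset.mul_sum, Finset.sum_mul]
    refine Finset.sum_congr rfl fun k _ => ?_
    rw [Finset.sum_eq_single i (by simp +contextual) (by simp),
      Finset.sum_eq_single i (by simp +contextual) (by simp)]
    simp
    ring
  rw [h]
  refine isChannel_krausMap ?_
  rw [← h, isometryDecoder_apply]
  simp

theorem conjTranspose_mul_isometryDecoder_mul {W : Matrix κ ι ℂ} (hW : Wᴴ * W = 1) (i : ι)
    (X : Matrix ι ι ℂ) : Wᴴ * isometryDecoder W i X * W = X := by
  have h1 : Wᴴ * (1 - W * Wᴴ) = 0 := by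
    rw [Matrix.mul_sub, ← Matrix.mul_assoc, hW]; simp
  rw [isometryDecoder_apply, Matrix.mul_add, Matrix.mul_smul, h1, smul_zero, add_zero,
    ← Matrix.mul_assoc, ← Matrix.mul_assoc, hW, Matrix.one_mul, Matrix.mul_assoc, hW,
    Matrix.mul_one]

/-- Frees the ancilla from being `Fin k`, so that the remaining sites of a tensor product can play
its role. The proof relabels `m` and rescales `X` to the unit sphere. -/
theorem enorm_amp_le (m : Type*) [Fintype m] [DecidableEq m]
    (T : Matrix κ κ ℂ →ₗ[ℂ] Matrix ι ι ℂ) (X : Matrix (κ × m) (κ × m) ℂ) :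
    ‖amp m T X‖ₑ ≤ cbNorm T * ‖X‖ₑ := by
  let e := Fintype.equivFin m
  have key : ∀ Y : Matrix (κ × m) (κ × m) ℂ, ‖Y‖ ≤ 1 → ‖amp m T Y‖ₑ ≤ cbNorm T := by
    intro Y hY
    have h1 : reindexHom ((Equiv.refl ι).prodCongr e) (amp m T Y) =
        ampliation T _ (reindexHom ((Equiv.refl κ).prodCongr e) Y) := rfl
    have h2 : ‖amp m T Y‖ₑ =
        ‖ampliation T _ (reindexHom ((Equiv.refl κ).prodCongr e) Y)‖ₑ := by
      rw [← h1, ← ofReal_norm, ← ofReal_norm, norm_reindexHom]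
    rw [h2]
    refine le_iSup₂_of_le _ _ (le_iSup_of_le ?_ le_rfl)
    rwa [norm_reindexHom]
  by_cases hX : X = 0
  · simp [hX]
  have hX' : ‖X‖ ≠ 0 := norm_ne_zero_iff.mpr hX
  have h := key ((‖X‖⁻¹ : ℂ) • X) (by
    rw [norm_smul, norm_inv, Complex.norm_real, norm_norm, inv_mul_cancel₀ hX'])
  have hXe : X = (‖X‖ : ℂ) • ((‖X‖⁻¹ : ℂ) • X) := by
    rw [smul_smul, mul_inv_cancel₀ (by exact_mod_cast hX'), one_smul]
  have hn : ‖(‖X‖ : ℂ)‖ₑ = ‖X‖ₑ := by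
    rw [← ofReal_norm, ← ofReal_norm, Complex.norm_real, norm_norm]
  conv_lhs => rw [hXe]
  rw [map_smul, enorm_smul, hn, mul_comm]
  gcongr

theorem cbNorm_le {T : Matrix κ κ ℂ →ₗ[ℂ] Matrix ι ι ℂ} {c : ℝ≥0∞}
    (h : ∀ (k : ℕ) (A : Matrix (κ × Fin k) (κ × Fin k) ℂ), ‖amp (Fin k) T A‖ₑ ≤ c * ‖A‖ₑ) :
    cbNorm T ≤ c := by
  refine iSup₂_le fun k A => iSup_le fun hA => (h k A).trans ?_
  have : ‖A‖ₑ ≤ 1 := by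
    rw [← ofReal_norm]; exact ENNReal.ofReal_le_one.mpr hA
  calc c * ‖A‖ₑ ≤ c * 1 := by gcongr
    _ = c := mul_one c

theorem cbNorm_comp_le (S : Matrix κ κ ℂ →ₗ[ℂ] Matrix ι ι ℂ) (T : Matrix μ μ ℂ →ₗ[ℂ] Matrix κ κ ℂ) :
    cbNorm (S ∘ₗ T) ≤ cbNorm S * cbNorm T := by
  refine cbNorm_le fun k A => ?_
  rw [amp_comp, mul_assoc]
  refine (enorm_amp_le _ S _).trans ?_
  gcongr
  exact enorm_amp_le _ T A

theorem cbNorm_zero : cbNorm (0 : Matrix κ κ ℂ →ₗ[ℂ] Matrix ι ι ℂ) = 0 := by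
  refine le_antisymm (cbNorm_le fun k A => ?_) zero_le
  have : amp (Fin k) (0 : Matrix κ κ ℂ →ₗ[ℂ] Matrix ι ι ℂ) A = 0 := rfl
  simp [this]

theorem cbNorm_add_le (S T : Matrix κ κ ℂ →ₗ[ℂ] Matrix ι ι ℂ) :
    cbNorm (S + T) ≤ cbNorm S + cbNorm T := by
  refine cbNorm_le fun k A => ?_
  rw [amp_add, LinearMap.add_apply, add_mul]
  exact (enorm_add_le _ _).trans (add_le_add (enorm_amp_le _ S A) (enorm_amp_le _ T A))

theorem cbNorm_sum_le {α : Type*} (s : Finset α) (T : α → Matrix κ κ ℂ →ₗ[ℂ] Matrix ι ι ℂ) :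
    cbNorm (∑ a ∈ s, T a) ≤ ∑ a ∈ s, cbNorm (T a) := by
  classical
  induction s using Finset.induction_on with
  | empty => simp [cbNorm_zero]
  | insert a s ha ih =>
    rw [Finset.sum_insert ha, Finset.sum_insert ha]
    exact (cbNorm_add_le _ _).trans (add_le_add le_rfl ih)

/-- Stinespring: stacking the Kraus operators into one column `V` writes the map as `Vᴴ (X ⊗ 1) V`,
and unitality says that `V` is an isometry. -/
theorem norm_krausMap_le {r : Type*} [Fintype r] [DecidableEq r] {K : r → Matrix κ ι ℂ}
    (hK : krausMap K 1 = 1) (X : Matrix κ κ ℂ) : ‖krausMap K X‖ ≤ ‖X‖ := by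
  let V : Matrix (κ × r) ι ℂ := of fun a b => K a.2 a.1 b
  have hV : ∀ X, krausMap K X = Vᴴ * tensorOne r X * V := by
    intro X
    ext a b
    simp [krausMap_apply, Matrix.sum_apply, mul_apply, tensorOne_apply, V, blockDiagonal_apply,
      Fintype.sum_prod_type_right]
  rcases isEmpty_or_nonempty ι with hι | hι
  · rw [Subsingleton.elim (krausMap K X) 0, norm_zero]; exact norm_nonneg X
  have h1 : ‖V‖ * ‖V‖ = 1 := by
    rw [← l2_opNorm_conjTranspose_mul_self, ← norm_one (α := Matrix ι ι ℂ), ← hK, hV, map_one,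
      Matrix.mul_one]
  have h2 : ‖V‖ = 1 := by nlinarith [norm_nonneg V]
  rw [hV]
  calc ‖Vᴴ * tensorOne r X * V‖ ≤ ‖Vᴴ‖ * ‖tensorOne r X‖ * ‖V‖ :=
        (l2_opNorm_mul _ _).trans (by gcongr; exact l2_opNorm_mul _ _)
    _ = ‖tensorOne r X‖ := by rw [l2_opNorm_conjTranspose, h2]; ring
    _ ≤ ‖X‖ := NonUnitalStarAlgHom.norm_apply_le _ _

theorem IsChannel.cbNorm_le_one {T : Matrix κ κ ℂ →ₗ[ℂ] Matrix ι ι ℂ} (hT : IsChannel T) :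
    cbNorm T ≤ 1 := by
  obtain ⟨K, rfl⟩ := hT.exists_krausMap
  refine cbNorm_le fun k A => ?_
  rw [one_mul, amp_krausMap, ← ofReal_norm, ← ofReal_norm]
  refine ENNReal.ofReal_le_ofReal (norm_krausMap_le ?_ A)
  rw [← amp_krausMap]
  have h := hT.unital
  ext ⟨a, i⟩ ⟨b, j⟩
  simp only [amp, LinearMap.coe_mk, AddHom.coe_mk, of_apply]
  have h2 : (of fun x y => (1 : Matrix (κ × Fin k) (κ × Fin k) ℂ) (x, i) (y, j)) =
      if i = j then (1 : Matrix κ κ ℂ) else 0 := by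
    ext x y
    split_ifs with hij <;> simp [one_apply, hij]
  rw [h2]
  split_ifs with hij
  · rw [h]; simp [one_apply, hij]
  · simp [hij]

end

/-! ### Tensor products of maps over a finite set of sites. -/

section

variable {α ι κ μ : Type*} [Fintype α] [DecidableEq α]

/-- The tensor product `⨂ᵢ A i` of a family of matrices. -/
def prodMatrix (A : α → Matrix ι κ ℂ) : Matrix (α → ι) (α → κ) ℂ :=
  of fun x y => ∏ i, A i (x i) (y i)

omit [DecidableEq α] in
@[simp]
theorem prodMatrix_apply (A : α → Matrix ι κ ℂ) (x : α → ι) (y : α → κ) :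
    prodMatrix A x y = ∏ i, A i (x i) (y i) := rfl

theorem prodMatrix_mul [Fintype κ] (A : α → Matrix ι κ ℂ) (B : α → Matrix κ μ ℂ) :
    prodMatrix A * prodMatrix B = prodMatrix fun i => A i * B i := by
  ext x y
  simp only [mul_apply, prodMatrix_apply, Fintype.prod_sum, Finset.prod_mul_distrib]

omit [DecidableEq α] in
theorem prodMatrix_single [DecidableEq κ] [DecidableEq ι] [DecidableEq (α → ι)]
    [DecidableEq (α → κ)] (x : α → ι) (y : α → κ) :
    prodMatrix (fun i => single (x i) (y i) (1 : ℂ)) = single x y 1 := by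
  ext a b
  simp only [prodMatrix_apply, single_apply, Finset.prod_ite_zero, Finset.prod_const_one,
    Finset.mem_univ, true_imp_iff, forall_and, funext_iff]

omit [DecidableEq α] in
theorem prodMatrix_one [DecidableEq κ] [DecidableEq (α → κ)] :
    prodMatrix (fun _ : α => (1 : Matrix κ κ ℂ)) = 1 := by
  ext a b
  simp only [prodMatrix_apply, one_apply, Finset.prod_ite_zero, Finset.prod_const_one,
    Finset.mem_univ, true_imp_iff, funext_iff]

omit [DecidableEq α] in
theorem prodMatrix_conjTranspose (A : α → Matrix ι κ ℂ) :
    (prodMatrix A)ᴴ = prodMatrix fun i => (A i)ᴴ := by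
  ext a b
  simp

omit [DecidableEq α] in
theorem linearMap_ext_prodMatrix [Fintype κ] [DecidableEq κ] {M : Type*} [AddCommMonoid M]
    [Module ℂ M] {S T : Matrix (α → κ) (α → κ) ℂ →ₗ[ℂ] M}
    (h : ∀ x y : α → κ, S (prodMatrix fun i => single (x i) (y i) 1) =
      T (prodMatrix fun i => single (x i) (y i) 1)) : S = T := by
  refine ext_linearMap _ fun x y => LinearMap.ext_ring ?_
  simp only [LinearMap.comp_apply, singleLinearMap_apply]
  rw [← prodMatrix_single, h]

/-- The product of the matrix entries `T i (E_{x i, y i}) (a i) (b i)`, as a multilinear function of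
the family `T`. -/
def entryProd [DecidableEq κ] (x y : α → κ) (a b : α → ι) :
    MultilinearMap ℂ (fun _ : α => Matrix κ κ ℂ →ₗ[ℂ] Matrix ι ι ℂ) ℂ :=
  (MultilinearMap.mkPiAlgebra ℂ α ℂ).compLinearMap fun i =>
    entryLinearMap ℂ ℂ (a i) (b i) ∘ₗ LinearMap.applyₗ (single (x i) (y i) (1 : ℂ))

/-- The tensor product `⨂ᵢ T i` of a family of linear maps, as a multilinear function of the
family. -/
def tensorMap [Fintype κ] [DecidableEq κ] :
    MultilinearMap ℂ (fun _ : α => Matrix κ κ ℂ →ₗ[ℂ] Matrix ι ι ℂ)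
      (Matrix (α → κ) (α → κ) ℂ →ₗ[ℂ] Matrix (α → ι) (α → ι) ℂ) where
  toFun T :=
    { toFun := fun X => of fun a b => ∑ x, ∑ y, X x y * entryProd x y a b T
      map_add' := fun X Y => by
        ext a b
        simp only [of_apply, Matrix.add_apply, add_mul, Finset.sum_add_distrib]
      map_smul' := fun c X => by
        ext a b
        simp only [of_apply, Matrix.smul_apply, smul_eq_mul, mul_assoc, Finset.mul_sum,
          RingHom.id_apply] }
  map_update_add' T i S S' := by
    refine LinearMap.ext fun X => ?_
    ext a b
    simp only [LinearMap.coe_mk, AddHom.coe_mk, LinearMap.add_apply, of_apply, Matrix.add_apply]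
    simp_rw [← Finset.sum_add_distrib, ← mul_add]
    refine Finset.sum_congr rfl fun x _ => Finset.sum_congr rfl fun y _ => ?_
    rw [← (entryProd x y a b).map_update_add]
  map_update_smul' T i c S := by
    refine LinearMap.ext fun X => ?_
    ext a b
    simp only [LinearMap.coe_mk, AddHom.coe_mk, LinearMap.smul_apply, of_apply, Matrix.smul_apply,
      smul_eq_mul, Finset.mul_sum]
    refine Finset.sum_congr rfl fun x _ => Finset.sum_congr rfl fun y _ => ?_
    rw [mul_left_comm, ← smul_eq_mul c, ← (entryProd x y a b).map_update_smul]

theorem tensorMap_apply [Fintype κ] [DecidableEq κ] (T : α → Matrix κ κ ℂ →ₗ[ℂ] Matrix ι ι ℂ)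
    (X : Matrix (α → κ) (α → κ) ℂ) (a b : α → ι) :
    tensorMap T X a b = ∑ x, ∑ y, X x y * ∏ i, T i (single (x i) (y i) 1) (a i) (b i) := rfl

theorem apply_eq_sum [Fintype κ] [DecidableEq κ] {M : Type*} [AddCommMonoid M] [Module ℂ M]
    (T : Matrix κ κ ℂ →ₗ[ℂ] M) (X : Matrix κ κ ℂ) :
    T X = ∑ x, ∑ y, X x y • T (single x y 1) := by
  conv_lhs => rw [matrix_eq_sum_single X]
  simp only [map_sum, ← map_smul, smul_single, smul_eq_mul, mul_one]

theorem tensorMap_prodMatrix [Fintype κ] [DecidableEq κ]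
    (T : α → Matrix κ κ ℂ →ₗ[ℂ] Matrix ι ι ℂ) (A : α → Matrix κ κ ℂ) :
    tensorMap T (prodMatrix A) = prodMatrix fun i => T i (A i) := by
  ext a b
  rw [tensorMap_apply, prodMatrix_apply]
  have h : ∀ i, T i (A i) (a i) (b i) =
      ∑ x, ∑ y, A i x y * T i (single x y 1) (a i) (b i) := fun i => by
    rw [apply_eq_sum (T i) (A i)]
    simp only [Matrix.sum_apply, Matrix.smul_apply, smul_eq_mul]
  simp only [h, Fintype.prod_sum, prodMatrix_apply, Finset.prod_mul_distrib]

theorem tensorMap_comp [Fintype κ] [DecidableEq κ] [Fintype μ] [DecidableEq μ]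
    (S : α → Matrix κ κ ℂ →ₗ[ℂ] Matrix ι ι ℂ) (T : α → Matrix μ μ ℂ →ₗ[ℂ] Matrix κ κ ℂ) :
    tensorMap S ∘ₗ tensorMap T = tensorMap fun i => S i ∘ₗ T i := by
  refine linearMap_ext_prodMatrix fun x y => ?_
  simp only [LinearMap.comp_apply, tensorMap_prodMatrix]

theorem tensorMap_id [Fintype κ] [DecidableEq κ] :
    tensorMap (fun _ : α => (LinearMap.id : Matrix κ κ ℂ →ₗ[ℂ] Matrix κ κ ℂ)) = LinearMap.id := by
  refine linearMap_ext_prodMatrix fun x y => ?_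
  simp only [LinearMap.id_apply, tensorMap_prodMatrix]

theorem tensorMap_one [Fintype κ] [DecidableEq κ] [DecidableEq ι]
    (T : α → Matrix κ κ ℂ →ₗ[ℂ] Matrix ι ι ℂ) :
    tensorMap T 1 = prodMatrix fun i => T i 1 := by
  rw [← prodMatrix_one, tensorMap_prodMatrix]

theorem tensorMap_sandwich [Fintype κ] [DecidableEq κ] (A : α → Matrix ι κ ℂ)
    (B : α → Matrix κ ι ℂ) :
    tensorMap (fun i => sandwich (A i) (B i)) = sandwich (prodMatrix A) (prodMatrix B) := by
  refine linearMap_ext_prodMatrix fun x y => ?_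
  simp only [tensorMap_prodMatrix, sandwich_apply, prodMatrix_mul]

variable [Fintype ι] [DecidableEq ι] [Fintype κ] [DecidableEq κ]

/-- Multilinearity distributes the tensor product over the Kraus sums, so products of Kraus
operators are Kraus operators of the product. -/
theorem isChannel_tensorMap {T : α → Matrix κ κ ℂ →ₗ[ℂ] Matrix ι ι ℂ} (hT : ∀ i, IsChannel (T i)) :
    IsChannel (tensorMap T) := by
  choose K hK using fun i => (hT i).exists_krausMap
  have h : tensorMap T = krausMap fun J : α → ι × Fin (Fintype.card κ) =>
      prodMatrix fun i => K i (J i) := by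
    have h1 : T = fun i => ∑ j, sandwich (K i j)ᴴ (K i j) := funext hK
    rw [h1, MultilinearMap.map_sum, krausMap]
    refine Finset.sum_congr rfl fun J _ => ?_
    rw [tensorMap_sandwich, prodMatrix_conjTranspose]
  have h1 : tensorMap T 1 = 1 := by
    rw [tensorMap_one, ← prodMatrix_one]
    exact congrArg _ (funext fun i => (hT i).unital)
  rw [h] at h1 ⊢
  exact isChannel_krausMap h1

/-- A linear map acting on the site `i` alone is an ampliation. -/
theorem tensorMap_update_id (i : α) (R : Matrix κ κ ℂ →ₗ[ℂ] Matrix κ κ ℂ)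
    (X : Matrix (α → κ) (α → κ) ℂ) :
    reindexHom (Equiv.funSplitAt i κ) (tensorMap (Function.update (fun _ => LinearMap.id) i R) X) =
      amp ({j // j ≠ i} → κ) R (reindexHom (Equiv.funSplitAt i κ) X) := by
  let f := (reindexHom (Equiv.funSplitAt i κ)).toAlgHom.toLinearMap
  suffices h : f ∘ₗ tensorMap (Function.update (fun _ => LinearMap.id) i R) =
      amp ({j // j ≠ i} → κ) R ∘ₗ f from LinearMap.congr_fun h X
  refine linearMap_ext_prodMatrix fun x y => ?_
  rw [LinearMap.comp_apply, tensorMap_prodMatrix]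
  ext ⟨a, c⟩ ⟨b, d⟩
  have hsplit : ∀ (a b : κ) (c d : {j // j ≠ i} → κ) (A : α → Matrix κ κ ℂ),
      f (prodMatrix A) (a, c) (b, d) = A i a b * ∏ j : {j // j ≠ i}, A j (c j) (d j) := by
    intro a b c d A
    change ∏ j, A j ((Equiv.funSplitAt i κ).symm (a, c) j) ((Equiv.funSplitAt i κ).symm (b, d) j) = _
    rw [Fintype.prod_eq_mul_prod_subtype_ne _ i]
    congr 1
    · simp [Equiv.funSplitAt, Equiv.piSplitAt]
    · refine Finset.prod_congr rfl fun j _ => ?_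
      simp [Equiv.funSplitAt, Equiv.piSplitAt, j.2]
  rw [hsplit]
  simp only [LinearMap.comp_apply, amp, LinearMap.coe_mk, AddHom.coe_mk, of_apply, hsplit,
    Function.update_self]
  have h2 : (of fun u v => single (x i) (y i) (1 : ℂ) u v *
        ∏ j : {j // j ≠ i}, single (x j) (y j) 1 (c j) (d j)) =
      (∏ j : {j // j ≠ i}, single (x j) (y j) (1 : ℂ) (c j) (d j)) • single (x i) (y i) (1 : ℂ) := by
    ext u v
    simp [mul_comm]
  rw [h2, map_smul, Matrix.smul_apply, smul_eq_mul, mul_comm]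
  congr 1
  refine Finset.prod_congr rfl fun j _ => ?_
  rw [Function.update_of_ne j.2, LinearMap.id_apply]

/-- Ampliating `S` by `Fin k` amounts to ampliating `T` by `m × Fin k`, which the cb-norm of `T`
already controls. -/
theorem cbNorm_le_of_amp {ι' κ' m : Type*} [Fintype ι'] [DecidableEq ι'] [Fintype κ']
    [DecidableEq κ'] [Fintype m] [DecidableEq m] (e : κ' ≃ κ × m) (e' : ι' ≃ ι × m)
    {S : Matrix κ' κ' ℂ →ₗ[ℂ] Matrix ι' ι' ℂ} {T : Matrix κ κ ℂ →ₗ[ℂ] Matrix ι ι ℂ}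
    (h : ∀ X, reindexHom e' (S X) = amp m T (reindexHom e X)) : cbNorm S ≤ cbNorm T := by
  refine cbNorm_le fun k A => ?_
  let g := (e.prodCongr (Equiv.refl (Fin k))).trans (Equiv.prodAssoc κ m (Fin k))
  let g' := (e'.prodCongr (Equiv.refl (Fin k))).trans (Equiv.prodAssoc ι m (Fin k))
  have h1 : reindexHom g' (amp (Fin k) S A) = amp (m × Fin k) T (reindexHom g A) := by
    ext ⟨a, c, i⟩ ⟨b, d, j⟩
    exact congrFun (congrFun (h (of fun x y => A (x, i) (y, j))) (a, c)) (b, d)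
  have h2 : ‖amp (Fin k) S A‖ₑ = ‖amp (m × Fin k) T (reindexHom g A)‖ₑ := by
    rw [← h1, ← ofReal_norm, ← ofReal_norm, norm_reindexHom]
  have h3 : ‖reindexHom g A‖ₑ = ‖A‖ₑ := by
    rw [← ofReal_norm, ← ofReal_norm, norm_reindexHom]
  rw [h2, ← h3]
  exact enorm_amp_le _ _ _

/-- The map is a composition of copies of `R` acting on one site each, and each of these is an
ampliation of `R` up to relabelling. -/
theorem cbNorm_tensorMap_ite_le (s : Finset α) (R : Matrix κ κ ℂ →ₗ[ℂ] Matrix κ κ ℂ) :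
    cbNorm (tensorMap fun i => if i ∈ s then R else LinearMap.id) ≤ cbNorm R ^ s.card := by
  induction s using Finset.induction_on with
  | empty =>
    simp only [Finset.notMem_empty, if_false, tensorMap_id, Finset.card_empty, pow_zero]
    exact isChannel_id.cbNorm_le_one
  | insert i s hi ih =>
    have h : (tensorMap fun j => if j ∈ insert i s then R else LinearMap.id) =
        tensorMap (Function.update (fun _ => LinearMap.id) i R) ∘ₗ
          tensorMap fun j => if j ∈ s then R else LinearMap.id := by
      rw [tensorMap_comp]
      congr 1
      funext j
      by_cases hj : j = i
      · subst hj; simp [hi]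
      · simp [hj]
    rw [h, Finset.card_insert_of_notMem hi, pow_succ']
    refine (cbNorm_comp_le _ _).trans ?_
    gcongr
    exact cbNorm_le_of_amp _ _ (tensorMap_update_id i R)

end

/-! ### Simulation of one map by another, and monotonicity of the coding error. -/

/-- `S` is obtained from `T` by preprocessing and postprocessing with channels. -/
def Simulates {ι κ ι' κ' : Type*} [Fintype ι] [DecidableEq ι] [Fintype κ] [DecidableEq κ]
    [Fintype ι'] [DecidableEq ι'] [Fintype κ'] [DecidableEq κ']
    (T : Matrix κ κ ℂ →ₗ[ℂ] Matrix ι ι ℂ) (S : Matrix κ' κ' ℂ →ₗ[ℂ] Matrix ι' ι' ℂ) : Prop :=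
  ∃ (E : Matrix ι ι ℂ →ₗ[ℂ] Matrix ι' ι' ℂ) (D : Matrix κ' κ' ℂ →ₗ[ℂ] Matrix κ κ ℂ),
    IsChannel E ∧ IsChannel D ∧ E ∘ₗ T ∘ₗ D = S

section

variable {ι κ ι' κ' ι'' κ'' : Type*} [Fintype ι] [DecidableEq ι] [Fintype κ] [DecidableEq κ]
  [Fintype ι'] [DecidableEq ι'] [Fintype κ'] [DecidableEq κ']
  [Fintype ι''] [DecidableEq ι''] [Fintype κ''] [DecidableEq κ'']
  {T : Matrix κ κ ℂ →ₗ[ℂ] Matrix ι ι ℂ} {S : Matrix κ' κ' ℂ →ₗ[ℂ] Matrix ι' ι' ℂ}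
  {R : Matrix κ'' κ'' ℂ →ₗ[ℂ] Matrix ι'' ι'' ℂ}

theorem Simulates.trans (h : Simulates T S) (h' : Simulates S R) : Simulates T R := by
  obtain ⟨E, D, hE, hD, rfl⟩ := h
  obtain ⟨E', D', hE', hD', rfl⟩ := h'
  exact ⟨E' ∘ₗ E, D ∘ₗ D', hE'.comp hE, hD.comp hD', rfl⟩

theorem Simulates.tensorMap {α : Type*} [Fintype α] [DecidableEq α] (h : Simulates T S) :
    Simulates (tensorMap fun _ : α => T) (tensorMap fun _ : α => S) := by
  obtain ⟨E, D, hE, hD, rfl⟩ := h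
  refine ⟨QuantumChannel.tensorMap fun _ => E, QuantumChannel.tensorMap fun _ => D,
    isChannel_tensorMap fun _ => hE, isChannel_tensorMap fun _ => hD, ?_⟩
  rw [tensorMap_comp, tensorMap_comp]

theorem Simulates.exists_scheme (h : Simulates T S) {M : ℕ}
    {E : Matrix ι' ι' ℂ →ₗ[ℂ] Matrix (Fin M) (Fin M) ℂ}
    {D : Matrix (Fin M) (Fin M) ℂ →ₗ[ℂ] Matrix κ' κ' ℂ} (hE : IsChannel E) (hD : IsChannel D) :
    ∃ (E' : Matrix ι ι ℂ →ₗ[ℂ] Matrix (Fin M) (Fin M) ℂ)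
      (D' : Matrix (Fin M) (Fin M) ℂ →ₗ[ℂ] Matrix κ κ ℂ), IsChannel E' ∧ IsChannel D' ∧
      schemeError T E' D' = schemeError S E D := by
  obtain ⟨E₀, D₀, hE₀, hD₀, rfl⟩ := h
  exact ⟨E ∘ₗ E₀, D₀ ∘ₗ D, hE.comp hE₀, hD₀.comp hD, rfl⟩

theorem codingError_le {M : ℕ} {E : Matrix ι ι ℂ →ₗ[ℂ] Matrix (Fin M) (Fin M) ℂ}
    {D : Matrix (Fin M) (Fin M) ℂ →ₗ[ℂ] Matrix κ κ ℂ} (hE : IsChannel E) (hD : IsChannel D) :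
    codingError T M ≤ schemeError T E D :=
  iInf₂_le_of_le E D (iInf₂_le_of_le hE hD le_rfl)

theorem Simulates.codingError_le (h : Simulates T S) (M : ℕ) :
    codingError T M ≤ codingError S M := by
  refine le_iInf₂ fun E D => le_iInf₂ fun hE hD => ?_
  obtain ⟨E', D', hE', hD', hED⟩ := h.exists_scheme hE hD
  exact hED ▸ QuantumChannel.codingError_le hE' hD'

/-- The isometry of `ℂ^ι'` into `ℂ^ι` given by an injection of the bases. -/
def basisIsometry (f : ι' → ι) : Matrix ι ι' ℂ := of fun x a => if x = f a then 1 else 0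

omit [Fintype ι'] [Fintype ι] [DecidableEq ι'] in
theorem basisIsometry_apply (f : ι' → ι) (x : ι) (a : ι') :
    basisIsometry f x a = if x = f a then 1 else 0 := rfl

omit [Fintype ι'] [DecidableEq ι'] in
theorem basisIsometry_sandwich (f : ι' → ι) (X : Matrix ι ι ℂ) :
    (basisIsometry f)ᴴ * X * basisIsometry f = X.submatrix f f := by
  ext a b
  simp [mul_apply, basisIsometry_apply]

omit [Fintype ι'] in
theorem basisIsometry_isometry {f : ι' → ι} (hf : f.Injective) :
    (basisIsometry f)ᴴ * basisIsometry f = 1 := by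
  rw [← Matrix.mul_one (basisIsometry f)ᴴ, basisIsometry_sandwich, submatrix_one _ hf]

theorem isChannel_basisIsometry {f : ι' → ι} (hf : f.Injective) :
    IsChannel (sandwich (basisIsometry f)ᴴ (basisIsometry f)) :=
  isChannel_sandwich (basisIsometry_isometry hf)

/-- The small system is a coordinate subspace of the large one; compressing to it on the encoding
side undoes `isometryDecoder`. The latter needs a basis vector, hence `0 < M'`. -/
theorem codingError_anti {M' M : ℕ} (h0 : 0 < M') (h : M' ≤ M) :
    codingError T M' ≤ codingError T M := by
  refine le_iInf₂ fun E D => le_iInf₂ fun hE hD => ?_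
  have hf := Fin.castLE_injective h
  set V := basisIsometry (Fin.castLE h)
  have hV : Vᴴ * V = 1 := basisIsometry_isometry hf
  have e1 := isChannel_sandwich hV
  have e2 := isChannel_isometryDecoder hV ⟨0, h0⟩
  refine (QuantumChannel.codingError_le (e1.comp hE) (hD.comp e2)).trans ?_
  have h1 : sandwich Vᴴ V ∘ₗ isometryDecoder V ⟨0, h0⟩ = LinearMap.id :=
    LinearMap.ext fun X => conjTranspose_mul_isometryDecoder_mul hV _ X
  have h2 : (sandwich Vᴴ V ∘ₗ E) ∘ₗ T ∘ₗ D ∘ₗ isometryDecoder V ⟨0, h0⟩ - LinearMap.id =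
      sandwich Vᴴ V ∘ₗ (E ∘ₗ T ∘ₗ D - LinearMap.id) ∘ₗ isometryDecoder V ⟨0, h0⟩ := by
    rw [LinearMap.sub_comp, LinearMap.comp_sub, LinearMap.id_comp, h1]
    rfl
  rw [schemeError, h2]
  refine (cbNorm_comp_le _ _).trans ?_
  calc _ ≤ 1 * (cbNorm (E ∘ₗ T ∘ₗ D - LinearMap.id) * 1) := by
        gcongr
        · exact e1.cbNorm_le_one
        · refine (cbNorm_comp_le _ _).trans ?_
          gcongr
          exact e2.cbNorm_le_one
    _ = _ := by rw [one_mul, mul_one]; rfl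

theorem simulates_tensorMap_prod {α β : Type*} [Fintype α] [DecidableEq α] [Fintype β]
    [DecidableEq β] (T : Matrix κ κ ℂ →ₗ[ℂ] Matrix ι ι ℂ) :
    Simulates (tensorMap fun _ : α × β => T) (tensorMap fun _ : α => tensorMap fun _ : β => T) := by
  refine ⟨_, _, isChannel_starAlgHom (reindexHom (Equiv.curry α β ι)),
    isChannel_starAlgHom (reindexHom (Equiv.curry α β κ).symm), ?_⟩
  refine linearMap_ext_prodMatrix fun x y => ?_
  have h : ∀ A : α → β → Matrix κ κ ℂ,
      reindexHom (Equiv.curry α β κ).symm (prodMatrix fun i => prodMatrix (A i)) =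
        prodMatrix fun i => A i.1 i.2 := by
    intro A
    ext a b
    simp [Fintype.prod_prod_type, Function.curry]
  have h' : ∀ A : α → β → Matrix ι ι ℂ, reindexHom (Equiv.curry α β ι)
      (prodMatrix fun i => A i.1 i.2) = prodMatrix fun i => prodMatrix (A i) := by
    intro A
    ext a b
    simp [Fintype.prod_prod_type, Function.uncurry]
  simp only [← prodMatrix_single (α := β)]
  rw [tensorMap_prodMatrix]
  simp only [tensorMap_prodMatrix]
  change reindexHom (Equiv.curry α β ι) (QuantumChannel.tensorMap (fun _ : α × β => T)
    (reindexHom (Equiv.curry α β κ).symm _)) = _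
  rw [h, tensorMap_prodMatrix, ← h']

/-- The superfluous sites `γ` are fed the fixed basis state `i₀` and their outputs are ignored, that
is, measured with the observable `1`; `T 1 = 1` makes their factors equal to `1`. -/
theorem simulates_tensorMap_of_equiv {α β γ : Type*} [Fintype α] [DecidableEq α] [Fintype β]
    [DecidableEq β] [Fintype γ] [DecidableEq γ] [Nonempty ι] (hT : T 1 = 1) (e : α ⊕ γ ≃ β) :
    Simulates (tensorMap fun _ : β => T) (tensorMap fun _ : α => T) := by
  let g : (κ' : Type _) → (α → κ') × (γ → κ') ≃ (β → κ') := fun κ' =>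
    (Equiv.sumArrowEquivProdArrow α γ κ').symm.trans (Equiv.arrowCongr e (Equiv.refl κ'))
  obtain ⟨i₀⟩ := ‹Nonempty ι›
  let f : (α → ι) → (β → ι) := fun a j => Sum.elim a (fun _ => i₀) (e.symm j)
  have hf : f.Injective := fun a b hab => funext fun i => by
    simpa [f] using congrFun hab (e (Sum.inl i))
  refine ⟨_, _, isChannel_basisIsometry hf, (isChannel_starAlgHom (reindexHom (g κ))).comp
    (isChannel_starAlgHom (tensorOne (γ → κ))), ?_⟩
  refine linearMap_ext_prodMatrix fun x y => ?_
  have h : ∀ A : α → Matrix κ κ ℂ, reindexHom (g κ) (tensorOne (γ → κ) (prodMatrix A)) =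
      prodMatrix fun j => Sum.elim A (fun _ => 1) (e.symm j) := by
    intro A
    ext a b
    simp only [reindexHom_apply, tensorOne_apply, prodMatrix_apply]
    rw [← e.prod_comp, Fintype.prod_sum_type]
    simp only [e.symm_apply_apply, Sum.elim_inl, Sum.elim_inr]
    have h1 : ∏ j : γ, (1 : Matrix κ κ ℂ) (a (e (Sum.inr j))) (b (e (Sum.inr j))) =
        if (fun j => a (e (Sum.inr j))) = fun j => b (e (Sum.inr j)) then 1 else 0 := by
      simp only [one_apply, Finset.prod_ite_zero, Finset.prod_const_one, Finset.mem_univ,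
        true_imp_iff, funext_iff]
    rw [h1, mul_ite, mul_one, mul_zero]
    rfl
  change sandwich _ _ (QuantumChannel.tensorMap (fun _ : β => T)
    (reindexHom (g κ) (tensorOne (γ → κ) _))) = _
  rw [h, tensorMap_prodMatrix, tensorMap_prodMatrix, sandwich_apply, basisIsometry_sandwich]
  ext a b
  simp only [submatrix_apply, prodMatrix_apply]
  rw [← e.prod_comp, Fintype.prod_sum_type]
  simp [f, hT]

theorem simulates_tensorMap_of_card_le {α β : Type*} [Fintype α] [DecidableEq α] [Fintype β]
    [DecidableEq β] [Nonempty ι] (hT : T 1 = 1) (h : Fintype.card α ≤ Fintype.card β) :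
    Simulates (tensorMap fun _ : β => T) (tensorMap fun _ : α => T) := by
  have h1 : Fintype.card (α ⊕ Fin (Fintype.card β - Fintype.card α)) = Fintype.card β := by
    simp; omega
  exact simulates_tensorMap_of_equiv hT (Fintype.equivOfCardEq h1)

theorem simulates_tensorPower_tensorPower [Nonempty ι] (hT : T 1 = 1) {n k N : ℕ}
    (h : n * k ≤ N) : Simulates (tensorPower N T) (tensorPower n (tensorPower k T)) :=
  (simulates_tensorMap_of_card_le (α := Fin n × Fin k) hT (by simpa using h)).trans
    (simulates_tensorMap_prod T)

theorem simulates_tensorPower [Nonempty ι] (hT : T 1 = 1) {k N : ℕ}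
    (h : k ≤ N) : Simulates (tensorPower N T) (tensorPower k T) :=
  simulates_tensorMap_of_card_le hT (by simpa using h)

end

/-! ### Weyl operators and graph codes. -/

section

variable {p : ℕ} [Fact p.Prime]

/-- The Weyl (generalized Pauli) operator `X(a) Z(b)` of a `p`-level system, for `e = (a, b)`. -/
def weyl (e : ZMod p × ZMod p) : Matrix (ZMod p) (ZMod p) ℂ :=
  of fun y x => if y = x + e.1 then ZMod.stdAddChar (e.2 * x) else 0

theorem weyl_zero : weyl (0 : ZMod p × ZMod p) = 1 := by
  ext y x
  simp [weyl, one_apply]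

theorem stdAddChar_sum {α : Type*} (s : Finset α) (f : α → ZMod p) :
    (ZMod.stdAddChar (∑ i ∈ s, f i) : ℂ) = ∏ i ∈ s, ZMod.stdAddChar (f i) := by
  classical
  induction s using Finset.induction_on with
  | empty => simp
  | insert i s hi ih => rw [Finset.sum_insert hi, Finset.prod_insert hi, AddChar.map_add_eq_mul, ih]

theorem sum_stdAddChar_mul (c : ZMod p) :
    ∑ b : ZMod p, ZMod.stdAddChar (b * c) = if c = 0 then (p : ℂ) else 0 := by
  have h := AddChar.sum_mulShift c (ZMod.isPrimitive_stdAddChar p)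
  rw [h, ZMod.card]
  split_ifs <;> simp

theorem exists_eq_sum_weyl (A : Matrix (ZMod p) (ZMod p) ℂ) :
    ∃ c : ZMod p × ZMod p → ℂ, A = ∑ e, c e • weyl e := by
  have hp : (p : ℂ) ≠ 0 := by exact_mod_cast (Fact.out : p.Prime).ne_zero
  -- Fourier inversion along each cyclic diagonal `x ↦ (x + e.1, x)` of `A`.
  refine ⟨fun e => (p : ℂ)⁻¹ * ∑ x, A (x + e.1) x * ZMod.stdAddChar (e.2 * (-x)), ?_⟩
  ext y x
  simp only [Matrix.sum_apply, Matrix.smul_apply, weyl, of_apply, smul_eq_mul,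
    Fintype.sum_prod_type]
  rw [Finset.sum_eq_single (y - x)]
  · have h1 : ∀ b : ZMod p, (p : ℂ)⁻¹ * (∑ x', A (x' + (y - x)) x' *
          ZMod.stdAddChar (b * -x')) * ZMod.stdAddChar (b * x) =
        ∑ x', (p : ℂ)⁻¹ * A (x' + (y - x)) x' * ZMod.stdAddChar (b * (x - x')) := by
      intro b
      rw [Finset.mul_sum, Finset.sum_mul]
      refine Finset.sum_congr rfl fun x' _ => ?_
      rw [show b * (x - x') = b * -x' + b * x by ring, AddChar.map_add_eq_mul]
      ring
    simp only [add_sub_cancel, if_true, h1]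
    rw [Finset.sum_comm]
    simp only [← Finset.mul_sum, sum_stdAddChar_mul]
    rw [Finset.sum_eq_single x]
    · simp; field_simp
    · intro b _ hb; simp [sub_eq_zero, hb.symm]
    · simp
  · intro a _ ha
    refine Finset.sum_eq_zero fun b _ => ?_
    rw [if_neg, mul_zero]
    rintro rfl
    simp at ha
  · simp

theorem exists_eq_sum_sandwich_weyl
    (T : Matrix (ZMod p) (ZMod p) ℂ →ₗ[ℂ] Matrix (ZMod p) (ZMod p) ℂ) :
    ∃ c : (ZMod p × ZMod p) × (ZMod p × ZMod p) → ℂ,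
      T = ∑ q, c q • sandwich (weyl q.1)ᴴ (weyl q.2) := by
  let P := Submodule.span ℂ (Set.range fun q : (ZMod p × ZMod p) × (ZMod p × ZMod p) =>
    sandwich (weyl q.1)ᴴ (weyl q.2))
  suffices h : T ∈ P by
    obtain ⟨c, hc⟩ := (Submodule.mem_span_range_iff_exists_fun ℂ).mp h
    exact ⟨c, hc.symm⟩
  have h1 : ∀ A B : Matrix (ZMod p) (ZMod p) ℂ, sandwich A B ∈ P := by
    intro A B
    -- The adjoint is expanded because the left factor has to appear as `(weyl e)ᴴ`.
    obtain ⟨c, hc⟩ := exists_eq_sum_weyl Aᴴ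
    obtain ⟨d, hd⟩ := exists_eq_sum_weyl B
    have h2 : sandwich A B = ∑ e, ∑ e', (star (c e) * d e') • sandwich (weyl e)ᴴ (weyl e') := by
      refine LinearMap.ext fun X => ?_
      rw [sandwich_apply, ← conjTranspose_conjTranspose A, hc, hd]
      simp only [conjTranspose_sum, conjTranspose_smul, Matrix.sum_mul, Matrix.mul_sum,
        LinearMap.sum_apply, LinearMap.smul_apply, sandwich_apply, Matrix.smul_mul,
        Matrix.mul_smul, Finset.smul_sum, smul_smul]
      rw [Finset.sum_comm]
      simp only [mul_comm]
    rw [h2]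
    exact Submodule.sum_mem _ fun e _ => Submodule.sum_mem _ fun e' _ =>
      Submodule.smul_mem _ _ (Submodule.subset_span ⟨(e, e'), rfl⟩)
  have h2 : T = ∑ x, ∑ y, ∑ a, ∑ b,
      T (single x y 1) a b • sandwich (single a x 1) (single y b 1) := by
    refine LinearMap.ext fun X => ?_
    rw [apply_eq_sum T X]
    simp only [LinearMap.sum_apply, LinearMap.smul_apply, sandwich_apply]
    refine Finset.sum_congr rfl fun x _ => Finset.sum_congr rfl fun y _ => ?_
    conv_lhs => rw [matrix_eq_sum_single (T (single x y 1))]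
    simp only [Finset.smul_sum, smul_single, smul_eq_mul, single_mul_mul_single, one_mul, mul_one]
    simp only [mul_comm]
  rw [h2]
  exact Submodule.sum_mem _ fun x _ => Submodule.sum_mem _ fun y _ => Submodule.sum_mem _ fun a _ =>
    Submodule.sum_mem _ fun b _ => Submodule.smul_mem _ _ (h1 _ _)

variable {α β : Type*} [Fintype α] [DecidableEq α] [Fintype β]

/-- The set of sites on which a product of Weyl operators acts nontrivially. -/
def errorSupport (e : α → ZMod p × ZMod p) : Finset α := Finset.univ.filter fun i => e i ≠ 0

/-- The condition on the graph of a graph code ensuring that it detects, without degeneracy, all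
errors on at most `t` sites. -/
def DetectsErrors (U : Matrix α α (ZMod p)) (B : Matrix α β (ZMod p)) (t : ℕ) : Prop :=
  ∀ (e : α → ZMod p × ZMod p) (z : β → ZMod p), (errorSupport e).card ≤ t →
    (fun i => (e i).2) - (U + Uᵀ) *ᵥ (fun i => (e i).1) + B *ᵥ z = 0 → e = 0 ∧ z = 0

omit [DecidableEq α] in
theorem prodMatrix_weyl_apply (e : α → ZMod p × ZMod p) (y x : α → ZMod p) :
    prodMatrix (fun i => weyl (e i)) y x =
      if y = x + (fun i => (e i).1) then ZMod.stdAddChar ((fun i => (e i).2) ⬝ᵥ x) else 0 := by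
  simp only [prodMatrix_apply, weyl, of_apply, Finset.prod_ite_zero, Finset.mem_univ, true_imp_iff,
    funext_iff, Pi.add_apply, dotProduct, stdAddChar_sum]

/-- The encoding matrix of a graph code. -/
def graphCode (U : Matrix α α (ZMod p)) (B : Matrix α β (ZMod p)) :
    Matrix (α → ZMod p) (β → ZMod p) ℂ :=
  of fun y x => (Real.sqrt (Fintype.card (α → ZMod p)) : ℂ)⁻¹ *
    ZMod.stdAddChar (y ⬝ᵥ U *ᵥ y + y ⬝ᵥ B *ᵥ x)

theorem weyl_mul_graphCode_apply (U : Matrix α α (ZMod p)) (B : Matrix α β (ZMod p))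
    (e : α → ZMod p × ZMod p) (y : α → ZMod p) (x : β → ZMod p) :
    (prodMatrix (fun i => weyl (e i)) * graphCode U B) y x =
      ZMod.stdAddChar ((fun i => (e i).2) ⬝ᵥ (y - fun i => (e i).1)) *
        graphCode U B (y - fun i => (e i).1) x := by
  rw [mul_apply, Finset.sum_eq_single (y - fun i => (e i).1)]
  · rw [prodMatrix_weyl_apply, if_pos (by simp)]
  · intro z _ hz
    rw [prodMatrix_weyl_apply, if_neg, zero_mul]
    rintro rfl
    simp at hz
  · simp

theorem sum_stdAddChar_dotProduct (w : α → ZMod p) :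
    ∑ y : α → ZMod p, ZMod.stdAddChar (y ⬝ᵥ w) =
      if w = 0 then (Fintype.card (α → ZMod p) : ℂ) else 0 := by
  simp only [dotProduct, stdAddChar_sum]
  rw [← Fintype.prod_sum fun (i : α) (y : ZMod p) => ZMod.stdAddChar (y * w i)]
  simp only [sum_stdAddChar_mul, Finset.prod_ite_zero, Finset.mem_univ, true_imp_iff, funext_iff,
    Pi.zero_apply, Finset.prod_const, Fintype.card_fun, ZMod.card, Finset.card_univ]
  push_cast
  rfl

theorem star_stdAddChar (c : ZMod p) :
    star (ZMod.stdAddChar c : ℂ) = ZMod.stdAddChar (-c) := by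
  rw [AddChar.map_neg_eq_conj]
  rfl

/-- The entries of a displaced code word are quadratic phases with the same leading form `y ⬝ᵥ U *ᵥ
y`. In an inner product this form cancels, leaving a character sum that vanishes unless the linear
part does. The phase `C` matters only on the diagonal, where the inner product must be exactly `1`.
-/
theorem weyl_graphCode_inner (U : Matrix α α (ZMod p)) (B : Matrix α β (ZMod p))
    (e e' : α → ZMod p × ZMod p) (x x' : β → ZMod p) :
    ∃ C : ZMod p, (e = e' → x = x' → C = 0) ∧
    ∑ y, star ((prodMatrix (fun i => weyl (e i)) * graphCode U B) y x) *
        (prodMatrix (fun i => weyl (e' i)) * graphCode U B) y x' =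
      ZMod.stdAddChar C * if (fun i => ((e' - e) i).2) - (U + Uᵀ) *ᵥ (fun i => ((e' - e) i).1) +
        B *ᵥ (x' - x) = 0 then 1 else 0 := by
  have hw : (fun i => ((e' - e) i).2) - (U + Uᵀ) *ᵥ (fun i => ((e' - e) i).1) + B *ᵥ (x' - x) =
      ((fun i => (e' i).2) - (fun i => (e i).2)) -
        (U + Uᵀ) *ᵥ ((fun i => (e' i).1) - (fun i => (e i).1)) + B *ᵥ (x' - x) := rfl
  rw [hw]
  simp only [weyl_mul_graphCode_apply]
  set a := fun i => (e i).1
  set b := fun i => (e i).2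
  set a' := fun i => (e' i).1
  set b' := fun i => (e' i).2
  set w := (b' - b) - (U + Uᵀ) *ᵥ (a' - a) + B *ᵥ (x' - x)
  let C : ZMod p := b ⬝ᵥ a - b' ⬝ᵥ a' - a ⬝ᵥ U *ᵥ a + a' ⬝ᵥ U *ᵥ a' + a ⬝ᵥ B *ᵥ x - a' ⬝ᵥ B *ᵥ x'
  refine ⟨C, ?_, ?_⟩
  · rintro rfl rfl
    simp only [C, a', b']
    ring
  have hN : (Fintype.card (α → ZMod p) : ℂ) ≠ 0 := by exact_mod_cast Fintype.card_ne_zero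
  have hs : (Real.sqrt (Fintype.card (α → ZMod p)) : ℂ)⁻¹ *
      (Real.sqrt (Fintype.card (α → ZMod p)) : ℂ)⁻¹ = (Fintype.card (α → ZMod p) : ℂ)⁻¹ := by
    rw [← mul_inv, ← Complex.ofReal_mul, Real.mul_self_sqrt (by positivity)]
    simp
  -- The cross terms of the shifted quadratic forms combine into `U + Uᵀ`, the matrix occurring in
  -- `DetectsErrors`.
  have hexp : ∀ y, -(b ⬝ᵥ (y - a)) + (-((y - a) ⬝ᵥ U *ᵥ (y - a)) + -((y - a) ⬝ᵥ B *ᵥ x)) +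
      b' ⬝ᵥ (y - a') + ((y - a') ⬝ᵥ U *ᵥ (y - a') + (y - a') ⬝ᵥ B *ᵥ x') = C + y ⬝ᵥ w := by
    intro y
    have ht : ∀ u, y ⬝ᵥ Uᵀ *ᵥ u = u ⬝ᵥ U *ᵥ y := by
      intro u
      rw [mulVec_transpose, dotProduct_comm, ← dotProduct_mulVec]
    simp only [C, w, sub_dotProduct, dotProduct_sub, mulVec_sub, add_mulVec, dotProduct_add, ht]
    rw [dotProduct_comm b y, dotProduct_comm b' y]
    ring
  have hterm : ∀ y, star (ZMod.stdAddChar (b ⬝ᵥ (y - a)) * graphCode U B (y - a) x) *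
      (ZMod.stdAddChar (b' ⬝ᵥ (y - a')) * graphCode U B (y - a') x') =
      (Fintype.card (α → ZMod p) : ℂ)⁻¹ * ZMod.stdAddChar C * ZMod.stdAddChar (y ⬝ᵥ w) := by
    intro y
    rw [mul_assoc, ← AddChar.map_add_eq_mul, ← hexp, ← hs]
    simp only [graphCode, of_apply, star_mul', star_stdAddChar, AddChar.map_add_eq_mul, star_inv₀]
    rw [show star (Real.sqrt (Fintype.card (α → ZMod p)) : ℂ) =
      (Real.sqrt (Fintype.card (α → ZMod p)) : ℂ) from Complex.conj_ofReal _]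
    ring
  simp only [hterm, ← Finset.mul_sum, sum_stdAddChar_dotProduct]
  split_ifs
  · field_simp
  · simp

end

/-! ### Error correction by graph codes. -/

section

variable {p : ℕ} [Fact p.Prime] {α β : Type*} [Fintype α] [DecidableEq α] [Fintype β]
  [DecidableEq β]

/-- The isometry sending `x ⊗ e` to the code word `x` afflicted by the Weyl error `e`, for errors
on at most `f` sites. -/
def errorIsometry (U : Matrix α α (ZMod p)) (B : Matrix α β (ZMod p)) (f : ℕ) :
    Matrix (α → ZMod p)
      ((β → ZMod p) × {e : α → ZMod p × ZMod p // (errorSupport e).card ≤ f}) ℂ :=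
  of fun y q => (prodMatrix (fun i => weyl (q.2.1 i)) * graphCode U B) y q.1

theorem card_errorSupport_sub_le (e e' : α → ZMod p × ZMod p) :
    (errorSupport (e' - e)).card ≤ (errorSupport e').card + (errorSupport e).card := by
  refine (Finset.card_le_card ?_).trans (Finset.card_union_le _ _)
  intro i
  simp only [errorSupport, Finset.mem_filter, Finset.mem_univ, true_and, Finset.mem_union,
    Pi.sub_apply]
  intro h
  by_contra! h2
  exact h (by rw [h2.1, h2.2, sub_zero])

-- Two errors on at most `f` sites differ by an error on at most `2 f` sites, so detection up to `2
-- f` makes all the afflicted code words orthonormal.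
omit [DecidableEq β] in
theorem errorIsometry_isometry {U : Matrix α α (ZMod p)} {B : Matrix α β (ZMod p)} {f : ℕ}
    (h : DetectsErrors U B (2 * f)) : (errorIsometry U B f)ᴴ * errorIsometry U B f = 1 := by
  ext ⟨x, e⟩ ⟨x', e'⟩
  rw [mul_apply]
  obtain ⟨C, hC, hsum⟩ := weyl_graphCode_inner U B e.1 e'.1 x x'
  refine hsum.trans ?_
  by_cases hx : x = x' ∧ e = e'
  · obtain ⟨rfl, rfl⟩ := hx
    rw [hC rfl rfl]
    have : (0 : α → ZMod p) - (U + Uᵀ) *ᵥ (0 : α → ZMod p) + B *ᵥ (0 : β → ZMod p) = 0 := by simp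
    simp only [sub_self]
    exact (congrArg _ (if_pos this)).trans (by simp)
  · rw [if_neg, mul_zero, one_apply_ne]
    · simpa using hx
    · intro h0
      have h1 := h _ _ ((card_errorSupport_sub_le e.1 e'.1).trans (by
        have := e.2; have := e'.2; omega)) h0
      exact hx ⟨(sub_eq_zero.mp h1.2).symm, Subtype.ext (sub_eq_zero.mp h1.1).symm⟩

/-- The decoding of a graph code correcting errors on at most `f` sites. -/
def graphDecoder (U : Matrix α α (ZMod p)) (B : Matrix α β (ZMod p)) (f : ℕ) :
    Matrix (β → ZMod p) (β → ZMod p) ℂ →ₗ[ℂ] Matrix (α → ZMod p) (α → ZMod p) ℂ :=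
  isometryDecoder (errorIsometry U B f) (0, ⟨0, by simp [errorSupport]⟩) ∘ₗ
    (tensorOne _).toAlgHom.toLinearMap

theorem isChannel_graphDecoder {U : Matrix α α (ZMod p)} {B : Matrix α β (ZMod p)} {f : ℕ}
    (h : DetectsErrors U B (2 * f)) : IsChannel (graphDecoder U B f) :=
  (isChannel_isometryDecoder (errorIsometry_isometry h) _).comp (isChannel_starAlgHom _)

theorem errorIsometry_sandwich_graphDecoder {U : Matrix α α (ZMod p)} {B : Matrix α β (ZMod p)}
    {f : ℕ} (h : DetectsErrors U B (2 * f)) (X : Matrix (β → ZMod p) (β → ZMod p) ℂ) :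
    (errorIsometry U B f)ᴴ * graphDecoder U B f X * errorIsometry U B f = tensorOne _ X := by
  unfold graphDecoder
  rw [LinearMap.comp_apply, conjTranspose_mul_isometryDecoder_mul (errorIsometry_isometry h)]
  rfl

/-- A strong Knill-Laflamme condition: distinct correctable errors lead to orthogonal copies of the
code, and the decoder reads `X` off from each of them. -/
theorem weyl_sandwich_graphDecoder {U : Matrix α α (ZMod p)} {B : Matrix α β (ZMod p)} {f : ℕ}
    (h : DetectsErrors U B (2 * f)) {e e' : α → ZMod p × ZMod p} (he : (errorSupport e).card ≤ f)
    (he' : (errorSupport e').card ≤ f) (X : Matrix (β → ZMod p) (β → ZMod p) ℂ) :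
    (graphCode U B)ᴴ * ((prodMatrix fun i => weyl (e i))ᴴ * graphDecoder U B f X *
      prodMatrix fun i => weyl (e' i)) * graphCode U B = if e = e' then X else 0 := by
  set W := errorIsometry U B f
  have h1 : ∀ {e : α → ZMod p × ZMod p} (he : (errorSupport e).card ≤ f),
      prodMatrix (fun i => weyl (e i)) * graphCode U B = W.submatrix id fun x => (x, ⟨e, he⟩) :=
    fun he => rfl
  calc _ = (prodMatrix (fun i => weyl (e i)) * graphCode U B)ᴴ * graphDecoder U B f X *
        (prodMatrix (fun i => weyl (e' i)) * graphCode U B) := by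
        rw [conjTranspose_mul]; simp only [Matrix.mul_assoc]
    _ = (Wᴴ * graphDecoder U B f X * W).submatrix (fun x => (x, ⟨e, he⟩))
        fun x => (x, ⟨e', he'⟩) := by
        rw [h1 he, h1 he']
        ext a b
        simp only [mul_apply, submatrix_apply, conjTranspose_apply, id_eq]
    _ = _ := by
        rw [errorIsometry_sandwich_graphDecoder h]
        ext x x'
        by_cases hee : e = e' <;> simp [tensorOne_apply, blockDiagonal_apply, hee]

theorem graphCode_isometry {U : Matrix α α (ZMod p)} {B : Matrix α β (ZMod p)} {f : ℕ}
    (h : DetectsErrors U B (2 * f)) : (graphCode U B)ᴴ * graphCode U B = 1 := by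
  have h0 : (errorSupport (0 : α → ZMod p × ZMod p)).card ≤ f := by simp [errorSupport]
  have h1 := weyl_sandwich_graphDecoder h h0 h0 1
  simpa [weyl_zero, prodMatrix_one, (isChannel_graphDecoder h).unital] using h1

/-- Expanded in Weyl operators, `tensorMap T` involves only errors supported on `s`. The terms with
equal left and right errors return multiples of `X`, all others vanish. -/
theorem graphDecoder_corrects {U : Matrix α α (ZMod p)} {B : Matrix α β (ZMod p)} {f : ℕ}
    (h : DetectsErrors U B (2 * f)) {s : Finset α} (hs : s.card ≤ f)
    {T : α → Matrix (ZMod p) (ZMod p) ℂ →ₗ[ℂ] Matrix (ZMod p) (ZMod p) ℂ}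
    (hT : ∀ i ∉ s, T i = LinearMap.id) :
    ∃ r : ℂ, sandwich (graphCode U B)ᴴ (graphCode U B) ∘ₗ tensorMap T ∘ₗ graphDecoder U B f =
      r • LinearMap.id := by
  have hc : ∀ i, ∃ c : (ZMod p × ZMod p) × (ZMod p × ZMod p) → ℂ,
      (T i = ∑ q, c q • sandwich (weyl q.1)ᴴ (weyl q.2)) ∧ (i ∉ s → ∀ q, q ≠ 0 → c q = 0) := by
    intro i
    by_cases hi : i ∈ s
    · obtain ⟨c, hc⟩ := exists_eq_sum_sandwich_weyl (T i)
      exact ⟨c, hc, fun h => absurd hi h⟩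
    -- Off `s` the map is the identity, the sandwich by `weyl 0 = 1` alone.
    · refine ⟨Pi.single 0 1, ?_, fun _ q hq => Pi.single_eq_of_ne hq _⟩
      rw [Finset.sum_eq_single 0 (fun q _ hq => by simp [hq]) (by simp), hT i hi]
      refine LinearMap.ext fun X => ?_
      simp [weyl_zero]
  choose c hc hc0 using hc
  have hexp : tensorMap T = ∑ J : α → (ZMod p × ZMod p) × (ZMod p × ZMod p),
      (∏ i, c i (J i)) • sandwich (prodMatrix fun i => weyl (J i).1)ᴴ
        (prodMatrix fun i => weyl (J i).2) := by
    rw [show T = fun i => ∑ q, c i q • sandwich (weyl q.1)ᴴ (weyl q.2) from funext hc,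
      MultilinearMap.map_sum]
    refine Finset.sum_congr rfl fun J _ => ?_
    rw [MultilinearMap.map_smul_univ, tensorMap_sandwich, prodMatrix_conjTranspose]
  have hJ : ∀ J : α → (ZMod p × ZMod p) × (ZMod p × ZMod p), ∃ r : ℂ, ∀ X,
      (∏ i, c i (J i)) • ((graphCode U B)ᴴ * ((prodMatrix fun i => weyl (J i).1)ᴴ *
        graphDecoder U B f X * prodMatrix fun i => weyl (J i).2) * graphCode U B) = r • X := by
    intro J
    by_cases h0 : ∏ i, c i (J i) = 0
    · exact ⟨0, fun X => by rw [h0, zero_smul, zero_smul]⟩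
    · have hJs : ∀ i, J i ≠ 0 → i ∈ s := by
        intro i hi
        by_contra his
        exact h0 (Finset.prod_eq_zero (Finset.mem_univ i) (hc0 i his _ hi))
      have h1 : (errorSupport fun i => (J i).1).card ≤ f := by
        refine (Finset.card_le_card fun i hi => hJs i ?_).trans hs
        intro h
        simp [errorSupport, h] at hi
      have h2 : (errorSupport fun i => (J i).2).card ≤ f := by
        refine (Finset.card_le_card fun i hi => hJs i ?_).trans hs
        intro h
        simp [errorSupport, h] at hi
      refine ⟨(∏ i, c i (J i)) * if (fun i => (J i).1) = fun i => (J i).2 then 1 else 0,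
        fun X => ?_⟩
      rw [weyl_sandwich_graphDecoder h h1 h2]
      split_ifs <;> simp
  choose r hr using hJ
  refine ⟨∑ J, r J, LinearMap.ext fun X => ?_⟩
  rw [hexp]
  simp only [LinearMap.comp_apply, LinearMap.sum_apply, LinearMap.smul_apply, sandwich_apply,
    LinearMap.id_apply, Matrix.mul_sum, Matrix.sum_mul, Matrix.mul_smul, Matrix.smul_mul, hr,
    Finset.sum_smul]

/-- The decoded map is scalar, and evaluating it at `1` shows that the scalar is zero, because `R 1
= 0` at some site of `s`. -/
theorem graphDecoder_corrects_sub {U : Matrix α α (ZMod p)} {B : Matrix α β (ZMod p)} {f : ℕ}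
    (h : DetectsErrors U B (2 * f)) {s : Finset α} (hs : s.card ≤ f) (hne : s.Nonempty)
    {R : Matrix (ZMod p) (ZMod p) ℂ →ₗ[ℂ] Matrix (ZMod p) (ZMod p) ℂ} (hR : R 1 = 0) :
    sandwich (graphCode U B)ᴴ (graphCode U B) ∘ₗ
      tensorMap (fun i => if i ∈ s then R else LinearMap.id) ∘ₗ graphDecoder U B f = 0 := by
  obtain ⟨r, hr⟩ := graphDecoder_corrects h hs
    (T := fun i => if i ∈ s then R else LinearMap.id) (fun i hi => if_neg hi)
  have h1 := LinearMap.congr_fun hr 1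
  obtain ⟨i, hi⟩ := hne
  have h2 : tensorMap (fun i => if i ∈ s then R else LinearMap.id) 1 = 0 := by
    rw [tensorMap_one]
    ext a b
    exact Finset.prod_eq_zero (Finset.mem_univ i) (by simp [hi, hR])
  simp only [LinearMap.comp_apply, (isChannel_graphDecoder h).unital, h2, map_zero,
    LinearMap.smul_apply, LinearMap.id_apply] at h1
  rw [hr, (smul_eq_zero.mp h1.symm).resolve_right one_ne_zero, zero_smul]

theorem sandwich_graphCode_comp_graphDecoder {U : Matrix α α (ZMod p)} {B : Matrix α β (ZMod p)}
    {f : ℕ} (h : DetectsErrors U B (2 * f)) :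
    sandwich (graphCode U B)ᴴ (graphCode U B) ∘ₗ graphDecoder U B f = LinearMap.id := by
  obtain ⟨r, hr⟩ := graphDecoder_corrects h (s := ∅) (by simp) (T := fun _ => LinearMap.id)
    (fun i hi => rfl)
  rw [tensorMap_id, LinearMap.id_comp] at hr
  have h1 := LinearMap.congr_fun hr 1
  simp only [LinearMap.comp_apply, (isChannel_graphDecoder h).unital, sandwich_apply,
    Matrix.mul_one, graphCode_isometry h, LinearMap.smul_apply, LinearMap.id_apply] at h1
  have h2 := congrFun (congrFun h1 0) 0
  rw [hr]
  simp at h2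
  rw [← h2, one_smul]

theorem cbNorm_graphCode_le {U : Matrix α α (ZMod p)} {B : Matrix α β (ZMod p)} {f : ℕ}
    (h : DetectsErrors U B (2 * f)) {S : Matrix (ZMod p) (ZMod p) ℂ →ₗ[ℂ] Matrix (ZMod p) (ZMod p) ℂ}
    (hS : S 1 = 1) :
    cbNorm (sandwich (graphCode U B)ᴴ (graphCode U B) ∘ₗ tensorMap (fun _ : α => S) ∘ₗ
      graphDecoder U B f - LinearMap.id) ≤
      ∑ s : Finset α with f < s.card, cbNorm (S - LinearMap.id) ^ s.card := by
  set R := S - LinearMap.id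
  have hR : R 1 = 0 := by simp [R, hS]
  set E := sandwich (graphCode U B)ᴴ (graphCode U B)
  set D := graphDecoder U B f
  have hE : IsChannel E := isChannel_sandwich (graphCode_isometry h)
  have hD : IsChannel D := isChannel_graphDecoder h
  let τ : Finset α → _ := fun s => E ∘ₗ tensorMap (fun i => if i ∈ s then R else LinearMap.id) ∘ₗ D
  have h1 : E ∘ₗ tensorMap (fun _ : α => S) ∘ₗ D = ∑ s, τ s := by
    have : (fun _ : α => S) = (fun _ => R) + fun _ => LinearMap.id := by
      funext i; simp [R]
    -- Expansion of `(R + id)^{⊗α}` over the sets of sites carrying `R`.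
    rw [this, MultilinearMap.map_add_univ]
    refine LinearMap.ext fun X => ?_
    simp only [LinearMap.comp_apply, LinearMap.sum_apply, map_sum]
    rfl
  have h2 : τ ∅ = LinearMap.id := by
    simp only [τ, Finset.notMem_empty, if_false, tensorMap_id, LinearMap.id_comp]
    exact sandwich_graphCode_comp_graphDecoder h
  have h3 : E ∘ₗ tensorMap (fun _ : α => S) ∘ₗ D - LinearMap.id =
      ∑ s : Finset α with f < s.card, τ s := by
    rw [h1, ← h2, Finset.sum_filter, ← Finset.add_sum_erase _ _ (Finset.mem_univ ∅),
      ← Finset.add_sum_erase _ (fun s => if f < s.card then τ s else 0)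
        (Finset.mem_univ ∅)]
    simp only [Finset.card_empty, not_lt_zero, if_false, zero_add, add_sub_cancel_left]
    refine Finset.sum_congr rfl fun s hs => ?_
    split_ifs with hf
    · rfl
    · exact graphDecoder_corrects_sub h (not_lt.mp hf)
        (Finset.nonempty_iff_ne_empty.mpr (Finset.ne_of_mem_erase hs)) hR
  rw [h3]
  refine (cbNorm_sum_le _ _).trans (Finset.sum_le_sum fun s _ => ?_)
  calc cbNorm (τ s) ≤ 1 * (cbNorm R ^ s.card * 1) := by
        refine (cbNorm_comp_le _ _).trans ?_
        gcongr
        · exact hE.cbNorm_le_one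
        · refine (cbNorm_comp_le _ _).trans ?_
          gcongr
          · exact cbNorm_tensorMap_ite_le s R
          · exact hD.cbNorm_le_one
    _ = _ := by rw [one_mul, mul_one]

end

/-! ### Existence of codes by counting. -/

section

variable {p : ℕ} [Fact p.Prime] {α β : Type*} [Fintype α] [DecidableEq α] [Fintype β]
  [DecidableEq β]

/-- A packing bound: `g` attaches to each exceptional point as many perturbations as `W` has
elements, all of them distinct. -/
theorem card_mul_card_le_of_injOn {Ω W : Type*} [Fintype Ω] [Fintype W] (s : Finset Ω)
    (g : Ω → W → Ω) (hg : ∀ x ∈ s, ∀ x' ∈ s, ∀ w w', g x w = g x' w' → x = x' ∧ w = w') :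
    s.card * Fintype.card W ≤ Fintype.card Ω := by
  rw [← Finset.card_univ (α := W), ← Finset.card_product, ← Finset.card_univ (α := Ω)]
  refine Finset.card_le_card_of_injOn (fun q => g q.1 q.2) (fun _ _ => Finset.mem_univ _) ?_
  rintro ⟨x, w⟩ hx ⟨x', w'⟩ hx' h
  simp only [Finset.coe_product, Set.mem_prod, Finset.mem_coe] at hx hx'
  obtain ⟨rfl, rfl⟩ := hg x hx.1 x' hx'.1 w w' h
  rfl

/-- The pairs `(U, B)` for which the error `e` is not detected on account of `z`. -/
def undetected (e : α → ZMod p × ZMod p) (z : β → ZMod p) :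
    Finset (Matrix α α (ZMod p) × Matrix α β (ZMod p)) :=
  Finset.univ.filter fun q =>
    (fun i => (e i).2) - (q.1 + q.1ᵀ) *ᵥ (fun i => (e i).1) + q.2 *ᵥ z = 0

/-- The pair can be perturbed so as to shift the tested vector by a prescribed amount: through `B`
in all coordinates if `z ≠ 0`, through `U` in all but one if `z = 0`. That lost coordinate is the
factor `p` on the right. -/
theorem card_undetected_mul_le {e : α → ZMod p × ZMod p} {z : β → ZMod p}
    (h : ¬ (e = 0 ∧ z = 0)) :
    (undetected e z).card * p ^ Fintype.card α ≤
      p * Fintype.card (Matrix α α (ZMod p) × Matrix α β (ZMod p)) := by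
  have hp : 1 ≤ p := (Fact.out : p.Prime).one_le
  by_cases hz : z = 0
  · subst hz
    by_cases ha : ∃ i, (e i).1 ≠ 0
    · obtain ⟨i, hi⟩ := ha
      have h1 := card_mul_card_le_of_injOn (W := {j // j ≠ i} → ZMod p)
        (undetected e (0 : β → ZMod p))
        -- Row `j ≠ i` of `(U + Uᵀ) a`, where `a j = (e j).1`, changes by `w j`. The transposed term
        -- affects row `i` alone, so that row is given up.
        (fun q w => (q.1 + vecMulVec (fun j => if hj : j ≠ i then w ⟨j, hj⟩ else 0)
          (Pi.single i (e i).1⁻¹), q.2)) (by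
          rintro ⟨U, B⟩ hq ⟨U', B'⟩ hq' w w' hww
          simp only [undetected, Finset.mem_filter, Finset.mem_univ, true_and, mulVec_zero,
            add_zero, sub_eq_zero] at hq hq'
          simp only [Prod.mk.injEq] at hww
          obtain ⟨hU, rfl⟩ := hww
          have hw : w = w' := by
            funext j
            have h2 := congrFun (hq.symm.trans hq') j.1
            have h3 := congrFun (congrArg (fun Q => (Q + Qᵀ) *ᵥ fun i => (e i).1) hU) j.1
            simp only [add_mulVec, transpose_add, Pi.add_apply, transpose_vecMulVec,
              vecMulVec_mulVec, Pi.smul_apply, MulOpposite.smul_eq_mul_unop,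
              MulOpposite.unop_op, single_dotProduct, Pi.single_apply, j.2, if_false, zero_mul,
              add_zero] at h2 h3
            have h4 : w j * ((e i).1⁻¹ * (e i).1) = w' j * ((e i).1⁻¹ * (e i).1) := by
              rw [dif_pos j.2, dif_pos j.2] at h3
              linear_combination h3 - h2
            rwa [inv_mul_cancel₀ hi, mul_one, mul_one] at h4
          subst hw
          exact ⟨by rw [add_right_cancel hU], rfl⟩)
      have h2 : p ^ Fintype.card α = p * Fintype.card ({j // j ≠ i} → ZMod p) := by
        rw [Fintype.card_fun, ZMod.card, Fintype.card_subtype_compl, Fintype.card_subtype_eq,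
          ← pow_succ', Nat.sub_add_cancel (Fintype.card_pos_iff.mpr ⟨i⟩)]
      rw [h2, mul_left_comm]
      exact Nat.mul_le_mul_left p h1
    · push Not at ha
      -- Without shift part and with `z = 0` the condition reads `(e i).2 = 0` for all `i`,
      -- contradicting `e ≠ 0`.
      have h1 : undetected e (0 : β → ZMod p) = ∅ := by
        refine Finset.filter_eq_empty_iff.mpr fun q _ hq => h ⟨?_, rfl⟩
        rw [show (fun i => (e i).1) = 0 from funext ha, mulVec_zero, mulVec_zero, sub_zero,
          add_zero] at hq
        funext i
        exact Prod.ext (ha i) (congrFun hq i)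
      simp [h1]
  · obtain ⟨k, hk⟩ : ∃ k, z k ≠ 0 := by
      by_contra! hz'
      exact hz (funext hz')
    have h1 := card_mul_card_le_of_injOn (W := α → ZMod p) (undetected e z)
      (fun q w => (q.1, q.2 + vecMulVec w (Pi.single k (z k)⁻¹))) (by
        rintro ⟨U, B⟩ hq ⟨U', B'⟩ hq' w w' hww
        simp only [undetected, Finset.mem_filter, Finset.mem_univ, true_and] at hq hq'
        simp only [Prod.mk.injEq] at hww
        obtain ⟨rfl, hB⟩ := hww
        have h2 : B *ᵥ z = B' *ᵥ z := add_left_cancel (hq.trans hq'.symm)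
        have h3 := congrArg (fun Q => Q *ᵥ z) hB
        simp only [add_mulVec, h2, vecMulVec_mulVec, single_dotProduct, inv_mul_cancel₀ hk,
          MulOpposite.op_one, one_smul] at h3
        have hw := add_left_cancel h3
        subst hw
        exact ⟨by rw [add_right_cancel hB], rfl⟩)
    rw [Fintype.card_fun, ZMod.card] at h1
    exact h1.trans (Nat.le_mul_of_pos_left _ hp)

/-- The Weyl errors on at most `t` sites. -/
def lightErrors (p : ℕ) [Fact p.Prime] (α : Type*) [Fintype α] [DecidableEq α] (t : ℕ) :
    Finset (α → ZMod p × ZMod p) :=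
  Finset.univ.filter fun e => (errorSupport e).card ≤ t

/-- Union bound over the nonzero pairs `(e, z)`: each spoils at most a fraction `p / p ^ card α` of
all `(U, B)`. -/
theorem exists_detectsErrors {t : ℕ}
    (h : (lightErrors p α t).card * p ^ (Fintype.card β + 1) < p ^ Fintype.card α) :
    ∃ (U : Matrix α α (ZMod p)) (B : Matrix α β (ZMod p)), DetectsErrors U B t := by
  by_contra! hno
  let Ω := Matrix α α (ZMod p) × Matrix α β (ZMod p)
  let P := ((lightErrors p α t) ×ˢ (Finset.univ : Finset (β → ZMod p))).filter
    fun q => ¬ (q.1 = 0 ∧ q.2 = 0)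
  have hcover : (Finset.univ : Finset Ω) ⊆ P.biUnion fun q => undetected q.1 q.2 := by
    rintro ⟨U, B⟩ -
    have h1 := hno U B
    unfold DetectsErrors at h1
    push Not at h1
    obtain ⟨e, z, he, hez, hne⟩ := h1
    refine Finset.mem_biUnion.mpr ⟨(e, z), ?_, ?_⟩
    · simp only [P, lightErrors, Finset.mem_filter, Finset.mem_product, Finset.mem_univ, true_and,
        and_true, not_and]
      exact ⟨he, hne⟩
    · simpa [undetected] using hez
  have hΩ : 0 < Fintype.card Ω := Fintype.card_pos
  have h1 : Fintype.card Ω * p ^ Fintype.card α ≤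
      (lightErrors p α t).card * p ^ Fintype.card β * (p * Fintype.card Ω) := by
    calc Fintype.card Ω * p ^ Fintype.card α
        ≤ (∑ q ∈ P, (undetected q.1 q.2).card) * p ^ Fintype.card α := by
          gcongr
          exact (Finset.card_le_card hcover).trans Finset.card_biUnion_le
      _ = ∑ q ∈ P, (undetected q.1 q.2).card * p ^ Fintype.card α := Finset.sum_mul _ _ _
      _ ≤ P.card • (p * Fintype.card Ω) := Finset.sum_le_card_nsmul _ _ _ fun q hq =>
          card_undetected_mul_le (Finset.mem_filter.mp hq).2
      _ ≤ _ := by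
          rw [smul_eq_mul]
          gcongr
          refine (Finset.card_filter_le _ _).trans ?_
          rw [Finset.card_product, Finset.card_univ, Fintype.card_fun, ZMod.card]
  have h2 : p ^ Fintype.card α ≤ (lightErrors p α t).card * p ^ (Fintype.card β + 1) := by
    refine Nat.le_of_mul_le_mul_left (h1.trans (le_of_eq ?_)) hΩ
    rw [pow_succ]; ring
  exact absurd h (not_lt.mpr h2)

theorem card_lightErrors_le (t : ℕ) : (lightErrors p α t).card ≤
    (Finset.univ.filter fun s : Finset α => s.card ≤ t).card * p ^ (2 * t) := by
  have hp : 1 ≤ p := (Fact.out : p.Prime).one_le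
  let Q : Finset α → Finset (α → ZMod p × ZMod p) := fun s =>
    Fintype.piFinset fun i => if i ∈ s then Finset.univ else {0}
  have hQ : ∀ s, (Q s).card = p ^ (2 * s.card) := by
    intro s
    rw [Fintype.card_piFinset]
    have : ∀ i, (if i ∈ s then (Finset.univ : Finset (ZMod p × ZMod p)) else {0}).card =
        if i ∈ s then p ^ 2 else 1 := by
      intro i; split_ifs <;> simp [ZMod.card, sq]
    simp only [this, Finset.prod_ite_mem, Finset.univ_inter, Finset.prod_const, pow_mul]
  have h1 : lightErrors p α t ⊆
      (Finset.univ.filter fun s : Finset α => s.card ≤ t).biUnion Q := by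
    intro e he
    refine Finset.mem_biUnion.mpr ⟨errorSupport e, by simpa [lightErrors] using he, ?_⟩
    refine Fintype.mem_piFinset.mpr fun i => ?_
    by_cases hi : e i = 0 <;> simp [errorSupport, hi]
  refine (Finset.card_le_card h1).trans (Finset.card_biUnion_le.trans ?_)
  rw [← smul_eq_mul]
  refine Finset.sum_le_card_nsmul _ _ _ fun s hs => ?_
  rw [hQ]
  have := (Finset.mem_filter.mp hs).2
  gcongr

theorem cbNorm_reindex_sub_id_le {γ γ' : Type*} [Fintype γ] [DecidableEq γ] [Fintype γ']
    [DecidableEq γ'] (e : γ ≃ γ') (S : Matrix γ γ ℂ →ₗ[ℂ] Matrix γ γ ℂ) :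
    cbNorm ((reindexHom e).toAlgHom.toLinearMap ∘ₗ S ∘ₗ (reindexHom e.symm).toAlgHom.toLinearMap -
      LinearMap.id) ≤ cbNorm (S - LinearMap.id) := by
  set F := (reindexHom e).toAlgHom.toLinearMap
  set G := (reindexHom e.symm).toAlgHom.toLinearMap
  have h0 : F ∘ₗ G = LinearMap.id :=
    LinearMap.ext fun X => reindexHom_symm_reindexHom e.symm X
  have h1 : F ∘ₗ S ∘ₗ G - LinearMap.id = F ∘ₗ (S - LinearMap.id) ∘ₗ G := by
    rw [LinearMap.sub_comp, LinearMap.comp_sub, LinearMap.id_comp, h0]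
  rw [h1]
  calc _ ≤ 1 * (cbNorm (S - LinearMap.id) * 1) := by
        refine (cbNorm_comp_le _ _).trans ?_
        gcongr
        · exact (isChannel_starAlgHom _).cbNorm_le_one
        · refine (cbNorm_comp_le _ _).trans ?_
          gcongr
          exact (isChannel_starAlgHom _).cbNorm_le_one
    _ = _ := by rw [one_mul, mul_one]

theorem codingError_le_of_scheme {ι κ γ : Type*} [Fintype ι] [DecidableEq ι] [Fintype κ]
    [DecidableEq κ] [Fintype γ] [DecidableEq γ] {T : Matrix κ κ ℂ →ₗ[ℂ] Matrix ι ι ℂ}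
    {E : Matrix ι ι ℂ →ₗ[ℂ] Matrix γ γ ℂ} {D : Matrix γ γ ℂ →ₗ[ℂ] Matrix κ κ ℂ}
    (hE : IsChannel E) (hD : IsChannel D) {M : ℕ} (e : γ ≃ Fin M) :
    codingError T M ≤ cbNorm (E ∘ₗ T ∘ₗ D - LinearMap.id) :=
  (codingError_le ((isChannel_starAlgHom (reindexHom e)).comp hE)
    (hD.comp (isChannel_starAlgHom (reindexHom e.symm)))).trans
    (cbNorm_reindex_sub_id_le e (E ∘ₗ T ∘ₗ D))

theorem codingError_tensorPower_le {S : Matrix (ZMod p) (ZMod p) ℂ →ₗ[ℂ] Matrix (ZMod p) (ZMod p) ℂ}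
    (hS : S 1 = 1) {n m f : ℕ} (h : (lightErrors p (Fin n) (2 * f)).card * p ^ (m + 1) < p ^ n) :
    codingError (tensorPower n S) (p ^ m) ≤
      ∑ s : Finset (Fin n) with f < s.card, cbNorm (S - LinearMap.id) ^ s.card := by
  obtain ⟨U, B, hUB⟩ := exists_detectsErrors (p := p) (α := Fin n) (β := Fin m) (t := 2 * f)
    (by simpa using h)
  have e : (Fin m → ZMod p) ≃ Fin (p ^ m) := Fintype.equivFinOfCardEq (by simp [ZMod.card])
  exact (codingError_le_of_scheme (isChannel_sandwich (graphCode_isometry hUB))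
    (isChannel_graphDecoder hUB) e).trans (cbNorm_graphCode_le hUB hS)

theorem codingError_tensorPower_le_of_scheme {ι κ : Type*} [Fintype ι] [DecidableEq ι] [Nonempty ι]
    [Fintype κ] [DecidableEq κ] {T : Matrix κ κ ℂ →ₗ[ℂ] Matrix ι ι ℂ} (hT : IsChannel T) {k : ℕ}
    {E : Matrix (Fin k → ι) (Fin k → ι) ℂ →ₗ[ℂ] Matrix (Fin p) (Fin p) ℂ}
    {D : Matrix (Fin p) (Fin p) ℂ →ₗ[ℂ] Matrix (Fin k → κ) (Fin k → κ) ℂ} (hE : IsChannel E)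
    (hD : IsChannel D) {N n m f : ℕ} (hN : n * k ≤ N)
    (h : (lightErrors p (Fin n) (2 * f)).card * p ^ (m + 1) < p ^ n) :
    codingError (tensorPower N T) (p ^ m) ≤
      ∑ s : Finset (Fin n) with f < s.card, schemeError (tensorPower k T) E D ^ s.card := by
  let e : Fin p ≃ ZMod p := Fintype.equivOfCardEq (by simp [ZMod.card])
  let F := (reindexHom e).toAlgHom.toLinearMap
  let G := (reindexHom e.symm).toAlgHom.toLinearMap
  have hF : IsChannel F := isChannel_starAlgHom _
  have hG : IsChannel G := isChannel_starAlgHom _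
  let S := F ∘ₗ (E ∘ₗ tensorPower k T ∘ₗ D) ∘ₗ G
  have hS : IsChannel S :=
    hF.comp ((hE.comp ((isChannel_tensorMap fun _ => hT).comp hD)).comp hG)
  have hkS : Simulates (tensorPower k T) S :=
    ⟨F ∘ₗ E, D ∘ₗ G, hF.comp hE, hD.comp hG, by simp only [S, LinearMap.comp_assoc]⟩
  have hsim : Simulates (tensorPower N T) (tensorPower n S) :=
    (simulates_tensorPower_tensorPower hT.unital hN).trans hkS.tensorMap
  refine (hsim.codingError_le _).trans ((codingError_tensorPower_le hS.unital h).trans ?_)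
  refine Finset.sum_le_sum fun s _ => ?_
  gcongr
  exact cbNorm_reindex_sub_id_le e _

end

/-! ### Entropy and Chernoff estimates. -/

theorem card_filter_card_le_exp_binEntropy {n t : ℕ} {q : ℝ} (hq0 : 0 < q) (hq : q ≤ 1 / 2)
    (ht : (t : ℝ) ≤ q * n) :
    ((Finset.univ.filter fun s : Finset (Fin n) => s.card ≤ t).card : ℝ) ≤
      Real.exp (n * Real.binEntropy q) := by
  have h1q : 0 < 1 - q := by linarith
  -- The Bernoulli weights of all subsets add up to `1`. As `q ≤ 1 / 2`, sets with at most `q n`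
  -- elements weigh at least `exp (-n h(q))`, `h` the binary entropy, which bounds their number.
  have hsum : ∑ s : Finset (Fin n), q ^ s.card * (1 - q) ^ (n - s.card) = 1 := by
    have h := Fintype.sum_pow_mul_eq_add_pow (Fin n) q (1 - q)
    rw [Fintype.card_fin] at h
    rw [h]
    simp
  have hterm : ∀ s ∈ Finset.univ.filter fun s : Finset (Fin n) => s.card ≤ t,
      Real.exp (-(n * Real.binEntropy q)) ≤ q ^ s.card * (1 - q) ^ (n - s.card) := by
    intro s hs
    have hst : (s.card : ℝ) ≤ q * n := le_trans (by exact_mod_cast (Finset.mem_filter.mp hs).2) ht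
    have hsn : s.card ≤ n := by simpa using s.card_le_univ
    have hlog : Real.log q ≤ Real.log (1 - q) := Real.log_le_log hq0 (by linarith)
    rw [← Real.exp_log (by positivity : 0 < q ^ s.card * (1 - q) ^ (n - s.card)),
      Real.log_mul (by positivity) (by positivity), Real.log_pow, Real.log_pow, Nat.cast_sub hsn]
    refine Real.exp_le_exp.mpr ?_
    rw [Real.binEntropy, Real.log_inv, Real.log_inv]
    nlinarith
  have h2 := Finset.card_nsmul_le_sum _ _ _ hterm
  have h3 := h2.trans (Finset.sum_le_univ_sum_of_nonneg fun s => by positivity)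
  rw [hsum, nsmul_eq_mul, Real.exp_neg] at h3
  rwa [mul_inv_le_iff₀ (Real.exp_pos _), one_mul] at h3

/-- Chernoff bound with tilting parameter `l`: on large sets `1 ≤ exp (-θ n log l) l ^ s.card`, and
the full tilted sum is `(l Δ + 1) ^ n ≤ exp (θ n)`. There is decay once `l > e`, which is where the
constant `e` of the theorem comes from. -/
theorem sum_pow_card_le_exp {n f : ℕ} {Δ θ l : ℝ} (hΔ : 0 ≤ Δ) (hl : 1 ≤ l) (hlΔ : l * Δ ≤ θ)
    (hf : θ * n ≤ (f + 1 : ℕ)) :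
    ∑ s : Finset (Fin n) with f < s.card, Δ ^ s.card ≤ Real.exp (n * (θ * (1 - Real.log l))) := by
  have hl0 : 0 < l := by linarith
  have hsum : ∑ s : Finset (Fin n), (l * Δ) ^ s.card = (l * Δ + 1) ^ n := by
    have h := Fintype.sum_pow_mul_eq_add_pow (Fin n) (l * Δ) 1
    rw [Fintype.card_fin] at h
    rw [← h]
    simp
  calc ∑ s : Finset (Fin n) with f < s.card, Δ ^ s.card
      ≤ ∑ s : Finset (Fin n) with f < s.card, Real.exp (-(θ * n * Real.log l)) * (l * Δ) ^ s.card := by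
        refine Finset.sum_le_sum fun s hs => ?_
        have h1 : θ * n ≤ s.card := hf.trans (by exact_mod_cast (Finset.mem_filter.mp hs).2)
        have h2 : 1 ≤ Real.exp (-(θ * n * Real.log l)) * l ^ s.card := by
          rw [← Real.exp_log (by positivity : 0 < l ^ s.card), ← Real.exp_add, Real.log_pow]
          refine Real.one_le_exp ?_
          nlinarith [Real.log_nonneg hl]
        rw [mul_pow, ← mul_assoc]
        exact le_mul_of_one_le_left (by positivity) h2
    _ ≤ ∑ s : Finset (Fin n), Real.exp (-(θ * n * Real.log l)) * (l * Δ) ^ s.card :=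
        Finset.sum_le_univ_sum_of_nonneg fun s => by positivity
    _ = Real.exp (-(θ * n * Real.log l)) * (l * Δ + 1) ^ n := by rw [← Finset.mul_sum, hsum]
    _ ≤ Real.exp (-(θ * n * Real.log l)) * Real.exp θ ^ n := by
        gcongr
        exact (Real.add_one_le_exp _).trans (Real.exp_le_exp.mpr hlΔ)
    _ = _ := by
        rw [← Real.exp_nat_mul, ← Real.exp_add]
        ring_nf

/-- Each of `2 f` sites carries `p ^ 2` Weyl operators, hence `4 θ log p`. Of the term `2 log p`,
one half comes from the exponent `m + 1` and the other from rounding `M` up to a power of `p`. The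
entropy bound needs `2 θ ≤ 1 / 2`. -/
theorem lightErrors_mul_pow_lt {p : ℕ} [Fact p.Prime] {n f m M : ℕ} {θ r : ℝ} (hθ0 : 0 < θ)
    (hθ : θ < 1 / 4) (hf : (f : ℝ) ≤ θ * n) (hm : p ^ m ≤ p * M) (hM : (M : ℝ) ≤ Real.exp r)
    (h : n * (Real.binEntropy (2 * θ) + 4 * θ * Real.log p) + 2 * Real.log p + r <
      n * Real.log p) :
    (lightErrors p (Fin n) (2 * f)).card * p ^ (m + 1) < p ^ n := by
  have hp : (0 : ℝ) < p := by exact_mod_cast (Fact.out : p.Prime).pos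
  have hp1 : (1 : ℝ) ≤ p := by exact_mod_cast (Fact.out : p.Prime).one_le
  have hlog : 0 ≤ Real.log p := Real.log_nonneg hp1
  have h1 : ((lightErrors p (Fin n) (2 * f)).card : ℝ) ≤
      Real.exp (n * Real.binEntropy (2 * θ)) * Real.exp (4 * θ * n * Real.log p) := by
    calc ((lightErrors p (Fin n) (2 * f)).card : ℝ)
        ≤ (Finset.univ.filter fun s : Finset (Fin n) => s.card ≤ 2 * f).card *
          (p : ℝ) ^ (2 * (2 * f)) := by
          exact_mod_cast card_lightErrors_le (p := p) (α := Fin n) (2 * f)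
      _ ≤ _ := by
          gcongr
          · exact card_filter_card_le_exp_binEntropy (by linarith) (by linarith)
              (by push_cast; linarith)
          · rw [← Real.exp_log (by positivity : (0 : ℝ) < p ^ (2 * (2 * f))), Real.log_pow]
            refine Real.exp_le_exp.mpr (mul_le_mul_of_nonneg_right ?_ hlog)
            push_cast
            linarith
  have h2 : (p : ℝ) ^ (m + 1) ≤ Real.exp (2 * Real.log p) * Real.exp r := by
    have h3 : (p : ℝ) ^ m ≤ p * M := by exact_mod_cast hm
    have h4 : Real.exp (2 * Real.log p) = p * p := by
      rw [two_mul, Real.exp_add, Real.exp_log hp]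
    rw [h4, pow_succ]
    calc (p : ℝ) ^ m * p ≤ p * M * p := by gcongr
      _ ≤ p * Real.exp r * p := by gcongr
      _ = _ := by ring
  have h5 : ((lightErrors p (Fin n) (2 * f)).card : ℝ) * (p : ℝ) ^ (m + 1) < (p : ℝ) ^ n := by
    calc _ ≤ (Real.exp (n * Real.binEntropy (2 * θ)) * Real.exp (4 * θ * n * Real.log p)) *
          (Real.exp (2 * Real.log p) * Real.exp r) := by gcongr
      _ < Real.exp (n * Real.log p) := by
          rw [← Real.exp_add, ← Real.exp_add, ← Real.exp_add]
          refine Real.exp_lt_exp.mpr ?_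
          linarith
      _ = (p : ℝ) ^ n := by rw [Real.exp_nat_mul, Real.exp_log hp]
  exact_mod_cast h5

/-! ### The direct part: achievable rates from one scheme. -/

section

variable {ι κ : Type*} [Fintype ι] [DecidableEq ι] [Nonempty ι] [Fintype κ] [DecidableEq κ]
  {T : Matrix κ κ ℂ →ₗ[ℂ] Matrix ι ι ℂ}

theorem isAchievableRate_of_scheme {p : ℕ} [Fact p.Prime] (hT : IsChannel T) {k : ℕ} (hk : 1 ≤ k)
    {E : Matrix (Fin k → ι) (Fin k → ι) ℂ →ₗ[ℂ] Matrix (Fin p) (Fin p) ℂ}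
    {D : Matrix (Fin p) (Fin p) ℂ →ₗ[ℂ] Matrix (Fin k → κ) (Fin k → κ) ℂ} (hE : IsChannel E)
    (hD : IsChannel D) {Δ θ c : ℝ} (hΔ0 : 0 ≤ Δ)
    (hΔ : schemeError (tensorPower k T) E D = ENNReal.ofReal Δ)
    (hθ : Real.exp 1 * Δ < θ) (hθ4 : θ < 1 / 4) (hc : 0 ≤ c)
    (h : c * k * Real.log 2 + Real.binEntropy (2 * θ) + 4 * θ * Real.log p < Real.log p) :
    IsAchievableRate T c := by
  refine ⟨hc, ?_⟩
  have hp : p.Prime := Fact.out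
  have hθ0 : 0 < θ := lt_of_le_of_lt (by positivity) hθ
  have he : 0 < Real.exp 1 := Real.exp_pos 1
  obtain ⟨l, hl1, hllog, hlΔ⟩ : ∃ l : ℝ, 1 ≤ l ∧ 1 < Real.log l ∧ l * Δ ≤ θ := by
    -- `Δ'` lies strictly between `Δ` and `θ / e`; unlike `Δ` it is positive, so `l = θ / Δ'` makes
    -- sense and exceeds `e`.
    set Δ' := (Δ + θ / Real.exp 1) / 2
    have h0 : Δ < θ / Real.exp 1 := by rw [lt_div_iff₀ he]; linarith
    have h1 : Δ ≤ Δ' := by simp only [Δ']; linarith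
    have h2 : Δ' < θ / Real.exp 1 := by simp only [Δ']; linarith
    have h3 : 0 < Δ' := by simp only [Δ']; positivity
    have h4 : Real.exp 1 < θ / Δ' := by
      rw [lt_div_iff₀ h3, mul_comm]; rwa [lt_div_iff₀ he] at h2
    refine ⟨θ / Δ', ?_, ?_, ?_⟩
    · linarith [Real.add_one_le_exp (1 : ℝ)]
    · rwa [Real.lt_log_iff_exp_lt (by positivity)]
    · rw [div_mul_eq_mul_div, div_le_iff₀ h3]; gcongr
  set g := Real.log p - (c * k * Real.log 2 + Real.binEntropy (2 * θ) + 4 * θ * Real.log p)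
  have hg : 0 < g := by simp only [g]; linarith
  have hn : Filter.Tendsto (fun N : ℕ => ((N / k : ℕ) : ℝ)) Filter.atTop Filter.atTop :=
    tendsto_natCast_atTop_atTop.comp (Nat.tendsto_div_const_atTop (by omega))
  have hbound : ∀ᶠ N : ℕ in Filter.atTop,
      codingError (tensorPower N T) ⌊(2 : ℝ) ^ (c * N)⌋₊ ≤
        ENNReal.ofReal (Real.exp ((N / k : ℕ) * (θ * (1 - Real.log l)))) := by
    filter_upwards [(hn.atTop_mul_const hg).eventually_gt_atTop
      -- The gap `g` per block must absorb the fixed losses: `2 log p` for rounding, and `c k log 2`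
      -- for the up to `k - 1` uses of `T` left over in `N = n k + …`.
      (2 * Real.log p + c * k * Real.log 2)] with N hN
    set n := N / k
    set M := ⌊(2 : ℝ) ^ (c * N)⌋₊
    set f := ⌊θ * n⌋₊
    have hM1 : 1 ≤ M := by
      refine Nat.le_floor ?_
      exact_mod_cast Real.one_le_rpow (by norm_num) (by positivity)
    have hm : p ^ Nat.clog p M ≤ p * M := by
      rcases Nat.lt_or_ge 1 M with h1 | h1
      · have h2 := Nat.pow_pred_clog_lt_self hp.one_lt h1
        have h3 := Nat.clog_pos hp.one_lt h1
        have h4 : p ^ Nat.clog p M = p * p ^ (Nat.clog p M).pred := by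
          rw [← pow_succ', ← Nat.succ_eq_add_one, Nat.succ_pred_eq_of_pos h3]
        rw [h4]
        exact Nat.mul_le_mul_left p h2.le
      · rw [Nat.clog_of_right_le_one h1, pow_zero]
        exact Nat.mul_pos hp.pos hM1
    have hNk : (N : ℝ) ≤ k * (n + 1) := by
      have := Nat.lt_mul_div_succ N (by omega : 0 < k)
      exact_mod_cast this.le
    have hM : (M : ℝ) ≤ Real.exp (c * k * (n + 1) * Real.log 2) := by
      refine (Nat.floor_le (by positivity)).trans ?_
      rw [Real.rpow_def_of_pos (by norm_num)]
      refine Real.exp_le_exp.mpr ?_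
      have hl2 : 0 < Real.log 2 := Real.log_pos (by norm_num)
      rw [mul_comm (Real.log 2)]
      refine mul_le_mul_of_nonneg_right ?_ hl2.le
      rw [mul_assoc]
      gcongr
    have hf : (f : ℝ) ≤ θ * n := Nat.floor_le (by positivity)
    have hlight : (lightErrors p (Fin n) (2 * f)).card * p ^ (Nat.clog p M + 1) < p ^ n := by
      refine lightErrors_mul_pow_lt hθ0 hθ4 hf hm hM ?_
      simp only [g] at hN
      linarith
    calc codingError (tensorPower N T) M ≤ codingError (tensorPower N T) (p ^ Nat.clog p M) :=
          codingError_anti hM1 (Nat.le_pow_clog hp.one_lt M)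
      _ ≤ ∑ s : Finset (Fin n) with f < s.card, schemeError (tensorPower k T) E D ^ s.card :=
          codingError_tensorPower_le_of_scheme hT hE hD (Nat.div_mul_le_self N k) hlight
      _ = ENNReal.ofReal (∑ s : Finset (Fin n) with f < s.card, Δ ^ s.card) := by
          rw [hΔ, ENNReal.ofReal_sum_of_nonneg fun s _ => by positivity]
          simp only [ENNReal.ofReal_pow hΔ0]
      _ ≤ _ := by
          refine ENNReal.ofReal_le_ofReal (sum_pow_card_le_exp hΔ0 hl1 hlΔ ?_)
          push_cast
          exact (Nat.lt_floor_add_one _).le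
  have hlim : Filter.Tendsto (fun N : ℕ =>
      ENNReal.ofReal (Real.exp ((N / k : ℕ) * (θ * (1 - Real.log l))))) Filter.atTop (nhds 0) := by
    rw [← ENNReal.ofReal_zero]
    refine ENNReal.tendsto_ofReal (Real.tendsto_exp_atBot.comp ?_)
    exact hn.atTop_mul_const_of_neg (by nlinarith)
  exact tendsto_of_tendsto_of_tendsto_of_le_of_le' tendsto_const_nhds hlim
    (Filter.Eventually.of_forall fun _ => zero_le) hbound

/-- A unital linear map on the one-dimensional algebra is the identity. -/
theorem codingError_one (hT : IsChannel T) : codingError T 1 = 0 := by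
  obtain ⟨i⟩ := ‹Nonempty ι›
  have hE := isChannel_basisIsometry (f := fun _ : Fin 1 => i) (Function.injective_of_subsingleton _)
  have hD := (isChannel_starAlgHom (reindexHom (Equiv.uniqueProd κ (Fin 1)))).comp
    (isChannel_starAlgHom (tensorOne (κ := Fin 1) κ))
  refine le_antisymm ((codingError_le hE hD).trans ?_) zero_le
  have h1 := (hE.comp (hT.comp hD)).unital
  rw [schemeError]
  refine le_of_eq <| (congrArg cbNorm ?_).trans cbNorm_zero
  refine LinearMap.ext fun X => ?_
  have hX : X = X 0 0 • 1 := by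
    ext a b
    rw [Subsingleton.elim a 0, Subsingleton.elim b 0]
    simp
  rw [LinearMap.sub_apply, hX, map_smul, h1]
  simp

theorem capacity_nonneg (hT : IsChannel T) : 0 ≤ capacity T := by
  refine le_sSup ⟨0, ⟨le_rfl, ?_⟩, rfl⟩
  have h : ∀ n : ℕ, codingError (tensorPower n T) ⌊(2 : ℝ) ^ ((0 : ℝ) * n)⌋₊ = 0 := fun n => by
    have h1 : IsChannel (tensorPower n T) := isChannel_tensorMap fun _ => hT
    rw [zero_mul, Real.rpow_zero, Nat.floor_one]
    exact codingError_one h1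
  simp only [h, tendsto_const_nhds]

theorem H₂_mul_log (r : ℝ) : H₂ r * Real.log 2 = Real.binEntropy r := by
  have h2 : Real.log 2 ≠ 0 := (Real.log_pos (by norm_num)).ne'
  rw [H₂, Real.binEntropy, Real.log_inv, Real.log_inv, Real.logb, Real.logb]
  field_simp
  ring

theorem finiteCodingBound_le_capacity (hT : IsChannel T) {k p : ℕ} (hk : 1 ≤ k)
    (hp : p.Prime) {E : Matrix (Fin k → ι) (Fin k → ι) ℂ →ₗ[ℂ] Matrix (Fin p) (Fin p) ℂ}
    {D : Matrix (Fin p) (Fin p) ℂ →ₗ[ℂ] Matrix (Fin k → κ) (Fin k → κ) ℂ} (hE : IsChannel E)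
    (hD : IsChannel D)
    (herr : schemeError (tensorPower k T) E D < ENNReal.ofReal (1 / (2 * Real.exp 1))) :
    (finiteCodingBound k p (schemeError (tensorPower k T) E D).toReal : EReal) ≤ capacity T := by
  have : Fact p.Prime := ⟨hp⟩
  have htop : schemeError (tensorPower k T) E D ≠ ⊤ := (herr.trans ENNReal.ofReal_lt_top).ne
  set Δ := (schemeError (tensorPower k T) E D).toReal
  have hΔ0 : 0 ≤ Δ := ENNReal.toReal_nonneg
  have hΔ : schemeError (tensorPower k T) E D = ENNReal.ofReal Δ := (ENNReal.ofReal_toReal htop).symm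
  have he : 0 < Real.exp 1 := Real.exp_pos 1
  have hΔ2 : 2 * Real.exp 1 * Δ < 1 := by
    rw [hΔ, ENNReal.ofReal_lt_ofReal_iff (by positivity), lt_div_iff₀ (by positivity)] at herr
    linarith
  -- A rate strictly between the capacity and the bound would be achievable. It is nonnegative
  -- because the capacity is.
  by_contra! hlt
  obtain ⟨c, hc1, hc2⟩ := EReal.lt_iff_exists_real_btwn.mp hlt
  have hc0 : 0 ≤ c := by exact_mod_cast (capacity_nonneg hT).trans hc1.le
  have hc2 : c < finiteCodingBound k p Δ := by exact_mod_cast hc2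
  have hl2 : 0 < Real.log 2 := Real.log_pos (by norm_num)
  have hlp : 0 < Real.log p := Real.log_pos (by exact_mod_cast hp.one_lt)
  have hk0 : (0 : ℝ) < k := by exact_mod_cast hk
  have hmain : c * k * Real.log 2 + Real.binEntropy (2 * (Real.exp 1 * Δ)) +
      4 * (Real.exp 1 * Δ) * Real.log p < Real.log p := by
    have h1 : finiteCodingBound k p Δ * (k * Real.log 2) =
        Real.log p * (1 - 4 * Real.exp 1 * Δ) - Real.binEntropy (2 * Real.exp 1 * Δ) := by
      rw [← H₂_mul_log, finiteCodingBound, Real.logb]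
      field_simp
    have h2 := mul_lt_mul_of_pos_right hc2 (mul_pos hk0 hl2)
    rw [h1] at h2
    rw [← mul_assoc 2]
    linarith
  have hent : 0 ≤ Real.binEntropy (2 * (Real.exp 1 * Δ)) :=
    Real.binEntropy_nonneg (by positivity) (by linarith)
  -- Otherwise `4 e Δ log p` alone would reach `log p`, as the other terms are nonnegative.
  have hθ4 : Real.exp 1 * Δ < 1 / 4 := by
    have : 0 ≤ c * k * Real.log 2 := by positivity
    by_contra! hge
    nlinarith
  have hcont : Continuous fun θ : ℝ =>
      c * k * Real.log 2 + Real.binEntropy (2 * θ) + 4 * θ * Real.log p := by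
    have := Real.binEntropy_continuous
    fun_prop
  -- The strict inequalities persist for `θ` slightly above `e Δ`, leaving room for the exponential
  -- decay.
  have hev : ∀ᶠ θ in nhdsWithin (Real.exp 1 * Δ) (Set.Ioi (Real.exp 1 * Δ)),
      Real.exp 1 * Δ < θ ∧ θ < 1 / 4 ∧
        c * k * Real.log 2 + Real.binEntropy (2 * θ) + 4 * θ * Real.log p < Real.log p := by
    filter_upwards [self_mem_nhdsWithin, nhdsWithin_le_nhds (Iio_mem_nhds hθ4),
      nhdsWithin_le_nhds (hcont.continuousAt.eventually_lt continuousAt_const hmain)]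
      with θ h1 h2 h3 using ⟨h1, h2, h3⟩
  obtain ⟨θ, h1, h2, h3⟩ := hev.exists
  have hach := isAchievableRate_of_scheme hT hk hE hD hΔ0 hΔ h1 h2 hc0 h3
  exact absurd (le_sSup ⟨c, hach, rfl⟩ : (c : EReal) ≤ capacity T) (not_le.mpr hc1)

end

/-! ### The converse: schemes from achievable rates. -/

open Filter

theorem H₂_le_one {r : ℝ} : H₂ r ≤ 1 := by
  have hl2 : 0 < Real.log 2 := Real.log_pos (by norm_num)
  have h := Real.binEntropy_le_log_two (p := r)
  rw [← H₂_mul_log] at h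
  nlinarith

theorem le_finiteCodingBound {N p : ℕ} {c ε Δ : ℝ} (hN : 1 ≤ N) (hc : 1 ≤ c * N)
    (hp : c * N - 1 ≤ Real.logb 2 p) (hΔ : Δ ≤ ε) (hε : 4 * Real.exp 1 * ε ≤ 1) :
    (c - (N : ℝ)⁻¹) * (1 - 4 * Real.exp 1 * ε) - (N : ℝ)⁻¹ ≤ finiteCodingBound N p Δ := by
  have hN0 : (0 : ℝ) < N := by exact_mod_cast hN
  have he : 0 < Real.exp 1 := Real.exp_pos 1
  have h1 : c - (N : ℝ)⁻¹ = (c * N - 1) / N := by field_simp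
  rw [finiteCodingBound, h1, one_div]
  have h2 : (N : ℝ)⁻¹ * H₂ (2 * Real.exp 1 * Δ) ≤ (N : ℝ)⁻¹ :=
    mul_le_of_le_one_right (by positivity) H₂_le_one
  have h3 : (c * N - 1) / N * (1 - 4 * Real.exp 1 * ε) ≤
      Real.logb 2 p / N * (1 - 4 * Real.exp 1 * Δ) := by
    have h4 : 0 ≤ (c * N - 1) / N := div_nonneg (by linarith) hN0.le
    have h5 : (c * N - 1) / N ≤ Real.logb 2 p / N := by gcongr
    exact mul_le_mul h5 (by gcongr) (by linarith) (h4.trans h5)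
  linarith

section

variable {ι κ : Type*} [Fintype ι] [DecidableEq ι] [Fintype κ] [DecidableEq κ]
  {T : Matrix κ κ ℂ →ₗ[ℂ] Matrix ι ι ℂ}

theorem IsAchievableRate.eventually_exists_scheme {c ε : ℝ} (h : IsAchievableRate T c) (hc : 0 < c)
    (hε : 0 < ε) : ∀ᶠ N : ℕ in atTop, ∃ (p : ℕ)
      (E : Matrix (Fin N → ι) (Fin N → ι) ℂ →ₗ[ℂ] Matrix (Fin p) (Fin p) ℂ)
      (D : Matrix (Fin p) (Fin p) ℂ →ₗ[ℂ] Matrix (Fin N → κ) (Fin N → κ) ℂ),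
      p.Prime ∧ IsChannel E ∧ IsChannel D ∧ c * N - 1 ≤ Real.logb 2 p ∧
      schemeError (tensorPower N T) E D < ENNReal.ofReal ε := by
  have h1 : ∀ᶠ N : ℕ in atTop, 1 ≤ c * N :=
    (tendsto_natCast_atTop_atTop.const_mul_atTop hc).eventually_ge_atTop 1
  filter_upwards [h1, h.2.eventually_lt_const (ENNReal.ofReal_pos.mpr hε)] with N hN hlt
  set M := ⌊(2 : ℝ) ^ (c * N)⌋₊
  have hM2 : 2 ≤ M := by
    refine Nat.le_floor ?_
    calc ((2 : ℕ) : ℝ) = (2 : ℝ) ^ (1 : ℝ) := by simp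
      _ ≤ _ := Real.rpow_le_rpow_of_exponent_le (by norm_num) hN
  -- Bertrand's postulate at `M / 2`, nonzero since `M ≥ 2`: the prime satisfies `p ≤ M` and `M + 1
  -- ≤ 2 p`, so at most one bit is lost.
  obtain ⟨p, hp, hp1, hp2⟩ := Nat.exists_prime_lt_and_le_two_mul (M / 2) (by omega)
  have hlt' : codingError (tensorPower N T) p < ENNReal.ofReal ε :=
    (codingError_anti hp.pos (by omega)).trans_lt hlt
  simp only [codingError, iInf_lt_iff] at hlt'
  obtain ⟨E, D, hE, hD, hED⟩ := hlt'
  refine ⟨p, E, D, hp, hE, hD, ?_, hED⟩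
  have hp0 : (0 : ℝ) < p := by exact_mod_cast hp.pos
  have h2 : (2 : ℝ) ^ (c * N) ≤ 2 * p := by
    refine (Nat.lt_floor_add_one _).le.trans ?_
    have : M + 1 ≤ 2 * p := by omega
    exact_mod_cast this
  have h3 := Real.logb_le_logb_of_le (b := 2) (by norm_num) (by positivity) h2
  rw [Real.logb_rpow (by norm_num) (by norm_num), Real.logb_mul (by norm_num) hp0.ne',
    Real.logb_self_eq_one (by norm_num)] at h3
  linarith

theorem IsAchievableRate.le_of_mem_upperBounds {c : ℝ} (h : IsAchievableRate T c) (hc : 0 < c)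
    {b : EReal} (hb : b ∈ upperBounds (finiteCodingBounds T)) : (c : EReal) ≤ b := by
  have he : 0 < Real.exp 1 := Real.exp_pos 1
  have hε : ∀ ε : ℝ, 0 < ε → 4 * Real.exp 1 * ε ≤ 1 →
      ((c * (1 - 4 * Real.exp 1 * ε) : ℝ) : EReal) ≤ b := by
    intro ε hε hε1
    have hlim : Tendsto (fun N : ℕ => (((c - (N : ℝ)⁻¹) * (1 - 4 * Real.exp 1 * ε) - (N : ℝ)⁻¹ : ℝ)
        : EReal)) atTop (nhds ((c * (1 - 4 * Real.exp 1 * ε) : ℝ) : EReal)) := by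
      refine (continuous_coe_real_ereal.tendsto _).comp ?_
      have h0 : Tendsto (fun N : ℕ => (N : ℝ)⁻¹) atTop (nhds 0) := tendsto_inv_atTop_nhds_zero_nat
      simpa using ((tendsto_const_nhds.sub h0).mul_const (1 - 4 * Real.exp 1 * ε)).sub h0
    refine le_of_tendsto hlim ?_
    filter_upwards [h.eventually_exists_scheme hc hε, eventually_ge_atTop 1,
      (tendsto_natCast_atTop_atTop.const_mul_atTop hc).eventually_ge_atTop 1]
      with N ⟨p, E, D, hp, hE, hD, hlog, herr⟩ hN hcN
    have hΔ : (schemeError (tensorPower N T) E D).toReal ≤ ε :=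
      ENNReal.toReal_le_of_le_ofReal hε.le herr.le
    have hs : IsFiniteScheme T N p E D := by
      refine ⟨hN, hp, hE, hD, herr.trans_le (ENNReal.ofReal_le_ofReal ?_)⟩
      rw [le_div_iff₀ (by positivity)]
      nlinarith [mul_pos he hε]
    exact (EReal.coe_le_coe_iff.mpr (le_finiteCodingBound hN hcN hlog hΔ hε1)).trans
      (hb ⟨N, p, E, D, hs, rfl⟩)
  have hlim : Tendsto (fun ε : ℝ => ((c * (1 - 4 * Real.exp 1 * ε) : ℝ) : EReal))
      (nhdsWithin 0 (Set.Ioi 0)) (nhds (c : EReal)) := by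
    have h1 : Continuous fun ε : ℝ => ((c * (1 - 4 * Real.exp 1 * ε) : ℝ) : EReal) :=
      continuous_coe_real_ereal.comp (by fun_prop)
    simpa using (h1.tendsto 0).mono_left nhdsWithin_le_nhds
  refine le_of_tendsto hlim ?_
  have h1 : ∀ᶠ ε : ℝ in nhds 0, 4 * Real.exp 1 * ε < 1 :=
    (by fun_prop : Continuous fun ε : ℝ => 4 * Real.exp 1 * ε).continuousAt.eventually_lt
      continuousAt_const (by simp)
  filter_upwards [self_mem_nhdsWithin, nhdsWithin_le_nhds h1] with ε h2 h3
  exact hε ε h2 h3.le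

/-- A scheme on `k` uses is also one on `k * j` uses with the same `p` and error, so its value `x`
may be replaced by `x / j`, which tends to zero even if `x` is negative. -/
theorem nonneg_of_mem_upperBounds [Nonempty ι] (hT : T 1 = 1) (hne : (finiteCodingBounds T).Nonempty)
    {b : EReal} (hb : b ∈ upperBounds (finiteCodingBounds T)) : 0 ≤ b := by
  obtain ⟨-, k, p, E, D, hs, -⟩ := hne
  set x := finiteCodingBound k p (schemeError (tensorPower k T) E D).toReal with hx
  have hlim : Tendsto (fun j : ℕ => ((x * (j : ℝ)⁻¹ : ℝ) : EReal)) atTop (nhds 0) := by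
    rw [← EReal.coe_zero]
    refine (continuous_coe_real_ereal.tendsto _).comp ?_
    simpa using tendsto_inv_atTop_nhds_zero_nat.const_mul x
  refine le_of_tendsto hlim ?_
  filter_upwards [eventually_ge_atTop 1] with j hj
  have hkj : k ≤ k * j := Nat.le_mul_of_pos_right k hj
  obtain ⟨E', D', hE', hD', herr⟩ :=
    (simulates_tensorPower (T := T) hT hkj).exists_scheme hs.encoding hs.decoding
  refine hb ⟨k * j, p, E', D', ⟨hs.one_le.trans hkj, hs.prime, hE', hD', ?_⟩, ?_⟩
  · rw [herr]; exact hs.error_lt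
  · rw [herr, hx, finiteCodingBound, finiteCodingBound]
    have hk0 : (k : ℝ) ≠ 0 := by exact_mod_cast (Nat.one_le_iff_ne_zero.mp hs.one_le)
    have hj0 : (j : ℝ) ≠ 0 := by exact_mod_cast (Nat.one_le_iff_ne_zero.mp hj)
    congr 1
    push_cast
    field_simp

end

end

end QuantumChannel

theorem mainTheorem1 {ι κ : Type*} [Fintype ι] [DecidableEq ι] [Nonempty ι]
    [Fintype κ] [DecidableEq κ] [Nonempty κ]
    (T : Matrix κ κ ℂ →ₗ[ℂ] Matrix ι ι ℂ) (hT : QuantumChannel.IsChannel T) :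
    (∀ (k p : ℕ) (E : Matrix (Fin k → ι) (Fin k → ι) ℂ →ₗ[ℂ] Matrix (Fin p) (Fin p) ℂ)
        (D : Matrix (Fin p) (Fin p) ℂ →ₗ[ℂ] Matrix (Fin k → κ) (Fin k → κ) ℂ),
        1 ≤ k → p.Prime → QuantumChannel.IsChannel E → QuantumChannel.IsChannel D →
        QuantumChannel.schemeError (QuantumChannel.tensorPower k T) E D <
          ENNReal.ofReal (1 / (2 * Real.exp 1)) →
        (QuantumChannel.finiteCodingBound k p
          (QuantumChannel.schemeError (QuantumChannel.tensorPower k T) E D).toReal : EReal) ≤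
          QuantumChannel.capacity T) ∧
    ((QuantumChannel.finiteCodingBounds T).Nonempty →
      IsLUB (QuantumChannel.finiteCodingBounds T) (QuantumChannel.capacity T)) ∧
    (QuantumChannel.finiteCodingBounds T = ∅ → QuantumChannel.capacity T = 0) := by
  refine ⟨fun k p E D hk hp hE hD herr =>
    QuantumChannel.finiteCodingBound_le_capacity hT hk hp hE hD herr, fun hne => ⟨?_, ?_⟩,
    fun hempty => le_antisymm ?_ (QuantumChannel.capacity_nonneg hT)⟩
  · rintro - ⟨k, p, E, D, hs, rfl⟩
    exact QuantumChannel.finiteCodingBound_le_capacity hT hs.one_le hs.prime hs.encoding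
      hs.decoding hs.error_lt
  · intro b hb
    refine sSup_le ?_
    rintro - ⟨c, hc, rfl⟩
    rcases hc.1.eq_or_lt with h0 | h0
    · rw [← h0]
      exact QuantumChannel.nonneg_of_mem_upperBounds hT.unital hne hb
    · exact hc.le_of_mem_upperBounds h0 hb
  · refine sSup_le ?_
    rintro - ⟨c, hc, rfl⟩
    rcases hc.1.eq_or_lt with h0 | h0
    · rw [← h0]; rfl
    -- Every number bounds the empty set above, so `0` may serve as the upper bound.
    · exact (hc.le_of_mem_upperBounds h0 (b := 0) (by rw [hempty]; simp))
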